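/- **Setting.** A linear bandit instance consists of an arm set $\mathcal X\subset\mathbb R^d$ with $\|x\|_2\le 1$ for all $x\in\mathcal X$ and a parameter $\theta\in\mathbb R^d$ with $\|\theta\|_2\le 1$, such that an optimal arm $x^*\in\arg\max_{x\in\mathcal X}\theta^\top x$ exists. Each pull of an arm $x\in\mathcal X$ returns $\theta^\top x+\eta$, where, given the past, $\eta$ is a fresh draw from a law $\nu_x$ (depending measurably on $x$). The noise is symmetric and $\alpha$-heavy-tailed for some $\alpha>0$: for every $x\in\mathcal X$, $\nu_x$ is symmetric and $\alpha$ is the largest positive real number such that $\nu_x(|\eta|>y)\le 1/y^{\alpha}$ for all $y>0$. If $a_1,\dots,a_T$ are the arms pulled in the first $T$ pulls, the pseudo-regret is $\mathrm{Regret}(T)=\sum_{i=1}^{T}(\theta^\top x^*-\theta^\top a_i)$. **Mean of medians.** For $\varepsilon\in(0,1)$ put $k=\lceil \tilde n^{\varepsilon}\rceil$, $k'=\lfloor\tilde n/k\rfloor$. The mean of medians of $r_1,\dots,r_{\tilde n}$ is $\frac1{k'}\sum_{j=1}^{k'}\mathrm{median}(r_{(j-1)k+1},\dots,r_{jk})$.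 **Synthetic algorithm.** In each of its rounds $t=1,2,\dots$ the base bandit algorithm chooses an arm $x_t$; this arm is pulled $\tilde n$ times, and the mean of medians of the $\tilde n$ rewards is returned to the base algorithm as the reward $r_t$ of round $t$. **OFUL** (Abbasi-Yadkori et al.), for $1$-sub-Gaussian noise, parameter norm at most $1$, regularization $\lambda>0$ and confidence $\delta$. After $t$ rounds put $V_t=\lambda I+\sum_{s\le t}x_sx_s^\top$, $\hat\theta_t=V_t^{-1}\sum_{s\le t}r_sx_s$, and $$\mathcal C_t=\Bigl\{\vartheta:\ \|\hat\theta_t-\vartheta\|_{V_t}\le\sqrt{2\log\frac{\det(V_t)^{1/2}\det(\lambda I)^{-1/2}}{\delta}}+\sqrt\lambda\Bigr\},$$ where $\|v\|_{V}=\sqrt{v^\top Vv}$. In round $t+1$ OFUL chooses an arm $x_{t+1}$ for which there is $\tilde\theta_{t+1}$ with $(x_{t+1},\tilde\theta_{t+1})\in\arg\max_{(x,\vartheta)\in\mathcal X\times\mathcal C_t}x^\top\vartheta$ (ties are broken arbitrarily). **Statement.** For every $\lambda>0$ there is a constant $K>0$, depending only on $\lambda$, such that the following holds for all $d$, all $T\ge1$,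 $\alpha>0$, $\delta\in(0,1)$, every constant $C>0$ with $2\sqrt C\,e^{-\sqrt C/16}\le1$, and every linear bandit instance in $\mathbb R^d$ with symmetric $\alpha$-heavy-tailed noise. Let $$\tilde n=\Bigl\lceil\max\bigl\{C,\ (16\log(2T/\delta))^2,\ (2\cdot4^{2/\alpha}\log(4/\delta))^2\bigr\}\Bigr\rceil .$$ Then the synthetic algorithm with OFUL (confidence $\delta$) as the base algorithm, $\varepsilon=1/2$ and this $\tilde n$ satisfies, with probability at least $1-\delta$, $$\mathrm{Regret}(T)\ \le\ K\,d\,\sqrt{\tilde n\,T}\,\bigl(1+\log(T/\delta)\bigr);$$ in particular $\mathrm{Regret}(T)=\tilde{\mathcal O}\bigl(d\sqrt{\tilde nT}\log(T/\delta)\bigr)$. -/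

import Mathlib

open MeasureTheory ProbabilityTheory
open scoped InnerProductSpace Matrix

noncomputable section

namespace HeavyTailBandit

/-! ### Heavy-tailed linear bandits -/

/-- Arms and parameters live in `ℝ^d` with the Euclidean norm and inner product. -/
abbrev Vec (d : ℕ) : Type := EuclideanSpace ℝ (Fin d)

/-- A law `ρ` on `ℝ` is `α`-heavy-tailed: `α` is the largest positive real number such that
`ρ(|η| > y) ≤ 1 / y ^ α` for all `y > 0`. -/
def IsHeavyTail (α : ℝ) (ρ : Measure ℝ) : Prop :=
  IsGreatest {a : ℝ | 0 < a ∧ ∀ y : ℝ, 0 < y → ρ.real {z : ℝ | y < |z|} ≤ 1 / y ^ a} α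

/-- A law on `ℝ` is symmetric: `η` and `-η` have the same distribution. -/
def IsSymmetricLaw (ρ : Measure ℝ) : Prop :=
  ρ.map (fun z : ℝ => -z) = ρ

/-- The linear bandit instance with arm set `X`, parameter `θ` and noise law `ν x` of each arm `x`
(the reward of arm `x` is `⟪θ, x⟫ + η` with `η ∼ ν x`) has symmetric `α`-heavy-tailed noise. -/
structure IsHeavyTailInstance {d : ℕ} (α : ℝ) (X : Set (Vec d)) (θ : Vec d)
    (ν : Kernel (Vec d) ℝ) : Prop where
  norm_param_le : ‖θ‖ ≤ 1
  norm_arm_le : ∀ x ∈ X, ‖x‖ ≤ 1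
  symm : ∀ x ∈ X, IsSymmetricLaw (ν x)
  heavyTail : ∀ x ∈ X, IsHeavyTail α (ν x)

/-- The interaction of a learner with the instance `(θ, ν)`, pull by pull (pulls are numbered from
`0`): in pull `i` the arm `a i` is pulled and the reward `r i` is observed. `ℱ i` is the information
available just before pull `i`. The arm `a i` depends on that information only, and, given that
information, the noise `r i - ⟪θ, a i⟫` is a fresh draw from the noise law of the arm `a i`. -/
structure IsInteraction {d : ℕ} {Ω : Type*} [mΩ : MeasurableSpace Ω] (P : Measure Ω)
    (ℱ : Filtration ℕ mΩ) (θ : Vec d) (ν : Kernel (Vec d) ℝ)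
    (a : ℕ → Ω → Vec d) (r : ℕ → Ω → ℝ) : Prop where
  measurable_arm : ∀ i, Measurable[ℱ i] (a i)
  measurable_reward : ∀ i, Measurable[ℱ (i + 1)] (r i)
  noise_law : ∀ (i : ℕ) (A : Set Ω) (B : Set ℝ), MeasurableSet[ℱ i] A → MeasurableSet B →
    P (A ∩ {ω | r i ω - ⟪θ, a i ω⟫_ℝ ∈ B}) = ∫⁻ ω in A, ν (a i ω) B ∂P

/-- Cumulative pseudo-regret over the first `T` pulls `a 0, …, a (T - 1)`, with respect to the
arm `xstar`. -/
def regret {d : ℕ} (θ xstar : Vec d) (a : ℕ → Vec d) (T : ℕ) : ℝ :=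
  ∑ i ∈ Finset.range T, (⟪θ, xstar⟫_ℝ - ⟪θ, a i⟫_ℝ)

/-! ### The mean of medians estimator -/

/-- The `i`-th smallest (from `i = 0`) of the numbers `v 0, …, v (k - 1)`; `0` if `i ≥ k`. -/
def orderStat {k : ℕ} (v : Fin k → ℝ) (i : ℕ) : ℝ :=
  if h : i < k then v (Tuple.sort v ⟨i, h⟩) else 0

/-- The median: the middle order statistic if `k` is odd, the average of the two middle ones if
`k` is even. -/
def median {k : ℕ} (v : Fin k → ℝ) : ℝ :=
  (orderStat v ((k - 1) / 2) + orderStat v (k / 2)) / 2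

/-- Block length `k = ⌈n ^ ε⌉`. -/
def blockLength (n : ℕ) (ε : ℝ) : ℕ := ⌈(n : ℝ) ^ ε⌉₊

/-- Number of blocks `k' = ⌊n / k⌋`. -/
def blockCount (n : ℕ) (ε : ℝ) : ℕ := n / blockLength n ε

/-- Mean of medians of the `n` samples `v 0, …, v (n - 1)` with parameter `ε`. -/
def meanOfMedians (n : ℕ) (ε : ℝ) (v : ℕ → ℝ) : ℝ :=
  (1 / (blockCount n ε : ℝ)) * ∑ j ∈ Finset.range (blockCount n ε),
    median (fun i : Fin (blockLength n ε) => v (j * blockLength n ε + (i : ℕ)))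

/-! ### Bandit algorithms, OFUL, and the synthetic algorithm -/

/-- A bandit algorithm: after `t` rounds with the history `(x_0, r_0), …, (x_{t-1}, r_{t-1})` of
arms and rewards, the set of arms that it may choose next (any way of breaking ties is allowed). -/
abbrev BanditAlgorithm (d : ℕ) : Type := (t : ℕ) → (Fin t → Vec d × ℝ) → Set (Vec d)

/-- The regularized design matrix `V_t = lam • I + ∑ x_s x_sᵀ`. -/
def designMatrix {d t : ℕ} (lam : ℝ) (h : Fin t → Vec d × ℝ) : Matrix (Fin d) (Fin d) ℝ :=
  lam • (1 : Matrix (Fin d) (Fin d) ℝ) + ∑ s, Matrix.vecMulVec (h s).1.ofLp (h s).1.ofLp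

/-- The regularized least-squares estimate `V_t⁻¹ ∑ r_s x_s`. -/
def ridgeEstimate {d t : ℕ} (lam : ℝ) (h : Fin t → Vec d × ℝ) : Fin d → ℝ :=
  (designMatrix lam h)⁻¹ *ᵥ ∑ s, (h s).2 • (h s).1.ofLp

/-- The weighted norm `‖v‖_V = √(vᵀ V v)`. -/
def weightedNorm {d : ℕ} (V : Matrix (Fin d) (Fin d) ℝ) (v : Fin d → ℝ) : ℝ :=
  Real.sqrt (v ⬝ᵥ (V *ᵥ v))

/-- The OFUL confidence ellipsoid for `R`-sub-Gaussian noise, a parameter of norm at most `S`,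
regularization `lam` and confidence `δ`. -/
def confidenceSet {d t : ℕ} (R S lam δ : ℝ) (h : Fin t → Vec d × ℝ) : Set (Vec d) :=
  {ϑ | weightedNorm (designMatrix lam h) (ridgeEstimate lam h - ϑ.ofLp) ≤
    R * Real.sqrt (2 * Real.log
      (Real.sqrt (designMatrix lam h).det
        / Real.sqrt (lam • (1 : Matrix (Fin d) (Fin d) ℝ)).det / δ))
      + Real.sqrt lam * S}

/-- OFUL (optimism in the face of uncertainty) on the arm set `X`: choose the arm of a pair
`(x, ϑ)` that maximizes `⟪x, ϑ⟫` over `X × confidence set`. -/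
def OFUL {d : ℕ} (X : Set (Vec d)) (R S lam δ : ℝ) : BanditAlgorithm d := fun _ h =>
  {x | x ∈ X ∧ ∃ ϑ ∈ confidenceSet R S lam δ h,
    ∀ x' ∈ X, ∀ ϑ' ∈ confidenceSet R S lam δ h, ⟪x', ϑ'⟫_ℝ ≤ ⟪x, ϑ⟫_ℝ}

/-- The pulls `a` and rewards `r` are produced by the synthetic algorithm with input `(𝒜, ε, n)`:
in its round `t` the base algorithm `𝒜` chooses the arm `x t`; this arm is pulled `n` times (pulls
`t * n, …, t * n + n - 1`), and the mean of medians of the `n` rewards is returned to `𝒜` as the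
reward of its round `t`. -/
structure IsSyntheticRun {d : ℕ} (𝒜 : BanditAlgorithm d) (ε : ℝ) (n : ℕ)
    (x a : ℕ → Vec d) (r : ℕ → ℝ) : Prop where
  pull_eq : ∀ t i : ℕ, i < n → a (t * n + i) = x t
  choice : ∀ t : ℕ, x t ∈ 𝒜 t (fun s : Fin t =>
    (x s, meanOfMedians n ε (fun i => r ((s : ℕ) * n + i))))

/-- The number of pulls per round, for `ε = 1 / 2`. -/
def sampleSize (C α δ : ℝ) (T : ℕ) : ℕ :=
  ⌈max C (max ((16 * Real.log (2 * T / δ)) ^ 2)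
    ((2 * (4 : ℝ) ^ (2 / α) * Real.log (4 / δ)) ^ 2))⌉₊

end HeavyTailBandit

end

namespace HeavyTailBandit

/-! The mean of medians turns heavy-tailed noise into sub-Gaussian noise, up to a rare failure in
each round; OFUL is then analysed with that noise.

With `B = 4 ^ (1 / α)` a single noise exceeds `B` in absolute value with probability at most `1 /
4`. A block median exceeds `B` only if half of its block does, which a Chernoff bound makes
exponentially unlikely in the block length. Let `G` be the event that all block medians of a round
are at most `B`. Flipping the signs of one block preserves both the product law and `G`, and negates
one median only. Averaging over these flips replaces each factor of the moment generating function
by a `cosh`, so on `G` the mean of `K` medians is sub-Gaussian with variance proxy `B ^ 2 / K`,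
which is at most `1 / 2` by the choice of the sample size (`setLIntegral_exp_meanBlockMedian_le`).

This holds only on `G`, so each round is conditioned on `G` through a density process `N`. Under the
new measure the self-normalized process is a supermartingale by the method of mixtures
(`lintegral_stepFactor_le`), and Ville's inequality keeps it below `1 / δ ^ 2` with probability at
least `1 - δ ^ 2`. Since `N` is at most `p ^ (-m)`, with `p` a lower bound for the probability of
`G`, returning to `P` costs only a factor `p ^ m` (`IsInteraction.le_measure_expProcess_lt`). The
proxy `1 / 2` instead of `1` is what allows the threshold `1 / δ ^ 2` while OFUL uses confidence
`δ`; the gap between `δ ^ 2` and `δ` pays for the failures of `G`.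

The rest is deterministic: optimism and the elliptical potential lemma bound the regret of `m`
rounds by order `d √m` up to logarithms (`sum_regret_le`). Each round costs `n` pulls and `m * n ≤ 2
* T`, so `n √m ≤ √(2 n T)`. -/

/-! ### Order statistics and medians -/

open Finset in
lemma orderStat_le_iff {k : ℕ} (v : Fin k → ℝ) {i : ℕ} (hi : i < k) (c : ℝ) :
    orderStat v i ≤ c ↔ i < #{j | v j ≤ c} := by
  have h := Tuple.lt_card_le_iff_apply_le_of_monotone (f := v ∘ Tuple.sort v) (a := c) (j := ⟨i, hi⟩)
    (Tuple.monotone_sort v)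
  rw [orderStat, dif_pos hi]
  rw [Function.comp_apply] at h
  rw [← h]
  have : #{j | (v ∘ Tuple.sort v) j ≤ c} = #{j | v j ≤ c} :=
    Finset.card_equiv (Tuple.sort v) (by simp)
  rw [this]

open Finset in
lemma orderStat_lt_iff {k : ℕ} (v : Fin k → ℝ) {i : ℕ} (hi : i < k) (c : ℝ) :
    orderStat v i < c ↔ i < #{j | v j < c} := by
  have h := Tuple.lt_card_lt_iff_apply_lt_of_monotone (f := v ∘ Tuple.sort v) (a := c) (j := ⟨i, hi⟩)
    (Tuple.monotone_sort v)
  rw [orderStat, dif_pos hi]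
  rw [Function.comp_apply] at h
  rw [← h]
  have : #{j | (v ∘ Tuple.sort v) j < c} = #{j | v j < c} :=
    Finset.card_equiv (Tuple.sort v) (by simp)
  rw [this]

open Finset in
-- Negation reverses the sorted order. Counting entries on each side of a threshold avoids comparing
-- the two sorting permutations, which may differ on ties.
lemma orderStat_neg {k : ℕ} (v : Fin k → ℝ) {i : ℕ} (hi : i < k) :
    orderStat (-v) i = - orderStat v (k - 1 - i) := by
  refine eq_of_forall_ge_iff fun c => ?_
  rw [orderStat_le_iff _ hi, neg_le, ← not_lt, orderStat_lt_iff _ (by omega)]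
  have h1 : #{j | (-v) j ≤ c} = #{j | ¬ v j < -c} := by
    congr 1; ext j; simp [neg_le]
  have h2 := Finset.card_filter_add_card_filter_not (s := (univ : Finset (Fin k)))
    (fun j => v j < -c)
  rw [Finset.card_univ, Fintype.card_fin] at h2
  rw [h1]
  omega

lemma median_neg {k : ℕ} (v : Fin k → ℝ) : median (-v) = - median v := by
  rcases Nat.eq_zero_or_pos k with rfl | hk
  · simp [median, orderStat]
  rw [median, median, orderStat_neg _ (by omega), orderStat_neg _ (by omega),
    show k - 1 - (k - 1) / 2 = k / 2 by omega, show k - 1 - k / 2 = (k - 1) / 2 by omega]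
  ring

lemma orderStat_add_const {k : ℕ} (v : Fin k → ℝ) {i : ℕ} (hi : i < k) (c : ℝ) :
    orderStat (fun j => c + v j) i = c + orderStat v i := by
  refine eq_of_forall_ge_iff fun b => ?_
  rw [orderStat_le_iff _ hi, ← le_sub_iff_add_le', orderStat_le_iff _ hi]
  simp only [le_sub_iff_add_le']

lemma median_const_add {k : ℕ} (hk : 0 < k) (v : Fin k → ℝ) (c : ℝ) :
    median (fun j => c + v j) = c + median v := by
  rw [median, median, orderStat_add_const _ (by omega), orderStat_add_const _ (by omega)]
  ring

lemma measurable_orderStat {k : ℕ} (i : ℕ) : Measurable (fun v : Fin k → ℝ => orderStat v i) := by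
  by_cases hi : i < k
  · refine measurable_of_Iic fun c => ?_
    have : (fun v : Fin k → ℝ => orderStat v i) ⁻¹' Set.Iic c
        -- The count is written as a sum of indicators, so measurability never involves the sorting
        -- permutation.
        = {v | i < ∑ j, Set.indicator {v : Fin k → ℝ | v j ≤ c} (fun _ => (1 : ℕ)) v} := by
      ext v
      rw [Set.mem_preimage, Set.mem_Iic, orderStat_le_iff _ hi, Set.mem_ofPred_eq,
        Finset.card_filter]
      rfl
    rw [this]
    refine measurableSet_lt measurable_const ?_
    refine Finset.measurable_sum _ fun j _ => measurable_const.indicator ?_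
    exact measurableSet_le (measurable_pi_apply j) measurable_const
  · simp only [orderStat, dif_neg hi]; exact measurable_const

lemma measurable_median {k : ℕ} : Measurable (fun v : Fin k → ℝ => median v) :=
  ((measurable_orderStat _).add (measurable_orderStat _)).div_const 2

open Finset in
-- If the average of the two middle order statistics exceeds `B`, one of them does, and either
-- leaves at most half of the entries below `B`. The negative side follows by `median_neg`.
lemma card_of_lt_abs_median {k : ℕ} (v : Fin k → ℝ) {B : ℝ} (h : B < |median v|) :
    k ≤ 2 * #{j | B < |v j|} := by
  rcases Nat.eq_zero_or_pos k with rfl | hk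
  · simp
  have key : ∀ w : Fin k → ℝ, B < median w → k ≤ 2 * #{j | B < w j} := by
    intro w hw
    have : B < orderStat w ((k - 1) / 2) ∨ B < orderStat w (k / 2) := by
      by_contra! hcon
      rw [median] at hw; linarith [hcon.1, hcon.2]
    have h2 := Finset.card_filter_add_card_filter_not (s := (univ : Finset (Fin k)))
      (fun j => w j ≤ B)
    rw [Finset.card_univ, Fintype.card_fin] at h2
    simp only [not_le] at h2
    rcases this with h | h <;> rw [← not_le, orderStat_le_iff _ (by omega)] at h <;> omega
  rcases lt_abs.1 h with h | h
  · refine (key v h).trans ?_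
    gcongr with j
    exact le_abs_self _
  · rw [← median_neg] at h
    refine (key _ h).trans ?_
    gcongr with j
    exact neg_le_abs _

/-! ### Medians of independent symmetric samples -/

/-- The median of `k` independent samples with `ρ(|z| > B) ≤ 1 / 4` exceeds `B` with
exponentially small probability. -/
lemma measureReal_lt_abs_median_le (ρ : Measure ℝ) [IsProbabilityMeasure ρ] {B : ℝ}
    (hq : ρ.real {z : ℝ | B < |z|} ≤ 1 / 4) {n k : ℕ} (e : Fin k ↪ Fin n) :
    (Measure.pi (fun _ : Fin n => ρ)).real {z | B < |median (fun i => z (e i))|}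
      ≤ (Real.sqrt 3 / 2) ^ k := by
  have h3 : (0 : ℝ) < Real.sqrt 3 := by positivity
  have h3' : Real.sqrt 3 * Real.sqrt 3 = 3 := Real.mul_self_sqrt (by norm_num)
  have hS : MeasurableSet {z : ℝ | B < |z|} := measurableSet_lt measurable_const measurable_abs
  -- Chernoff weight: `√3` on exceedances and `1 / √3` otherwise. The value `t = √3` minimizes `t /
  -- 4 + (3 / 4) / t`, with minimum `√3 / 2`.
  let g : ℝ → ℝ := fun y =>
    (1 / Real.sqrt 3) + {z : ℝ | B < |z|}.indicator (fun _ => Real.sqrt 3 - 1 / Real.sqrt 3) y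
  have hg1 : ∀ y, B < |y| → g y = Real.sqrt 3 := by
    intro y hy; simp [g, Set.indicator_of_mem (show y ∈ {z : ℝ | B < |z|} from hy)]
  have hg2 : ∀ y, ¬ B < |y| → g y = 1 / Real.sqrt 3 := by
    intro y hy; simp [g, Set.indicator_of_notMem (show y ∉ {z : ℝ | B < |z|} from hy)]
  have hgpos : ∀ y, 0 < g y := by
    intro y
    by_cases hy : B < |y|
    · rw [hg1 y hy]; exact h3
    · rw [hg2 y hy]; positivity
  have hgi : Integrable g ρ :=
    (integrable_const _).add ((integrable_const _).indicator hS)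
  have hgint : ∫ y, g y ∂ρ ≤ Real.sqrt 3 / 2 := by
    have h1 : ∫ y, g y ∂ρ = 1 / Real.sqrt 3
        + ρ.real {z : ℝ | B < |z|} * (Real.sqrt 3 - 1 / Real.sqrt 3) := by
      simp only [g]
      rw [integral_add (integrable_const _) ((integrable_const _).indicator hS),
        integral_indicator_const _ hS]
      simp
    have h2 : 1 / Real.sqrt 3 = Real.sqrt 3 / 3 := by
      rw [div_eq_div_iff h3.ne' (by norm_num), h3']; norm_num
    rw [h1, h2]
    nlinarith
  -- Coordinates outside the block get weight `1`, so Fubini on the whole product yields the `k`-th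
  -- power.
  let f : Fin n → ℝ → ℝ := fun l y => if l ∈ Finset.univ.map e then g y else 1
  have hfprod : ∀ z : Fin n → ℝ, ∏ l, f l (z l) = ∏ i, g (z (e i)) := by
    intro z
    simp only [f]
    rw [Finset.prod_ite_mem, Finset.univ_inter, Finset.prod_map]
  have hfi : ∀ l, Integrable (f l) ρ := by
    intro l
    by_cases hl : l ∈ Finset.univ.map e
    · simpa only [f, if_pos hl] using hgi
    · simpa only [f, if_neg hl] using integrable_const _
  have hFi : Integrable (fun z : Fin n → ℝ => ∏ i, g (z (e i)))
      (Measure.pi (fun _ : Fin n => ρ)) := by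
    have := Integrable.fintype_prod (μ := fun _ : Fin n => ρ) hfi
    simpa only [hfprod] using this
  have hFint : ∫ z, ∏ i, g (z (e i)) ∂(Measure.pi (fun _ : Fin n => ρ))
      = (∫ y, g y ∂ρ) ^ k := by
    have := integral_fintype_prod_eq_prod (μ := fun _ : Fin n => ρ) f
    simp only [hfprod] at this
    rw [this]
    have h : ∀ l, ∫ y, f l y ∂ρ = if l ∈ Finset.univ.map e then ∫ y, g y ∂ρ else 1 := by
      intro l
      by_cases hl : l ∈ Finset.univ.map e
      · simp only [f, if_pos hl]
      · simp only [f, if_neg hl]; simp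
    simp only [h]
    rw [Finset.prod_ite_mem, Finset.univ_inter, Finset.prod_const]
    simp
  have hsub : {z : Fin n → ℝ | B < |median (fun i => z (e i))|}
      ⊆ {z | 1 ≤ ∏ i, g (z (e i))} := by
    intro z hz
    have hc := card_of_lt_abs_median _ hz
    have : ∏ i, g (z (e i)) =
        ∏ i, if B < |z (e i)| then Real.sqrt 3 else 1 / Real.sqrt 3 := by
      refine Finset.prod_congr rfl fun i _ => ?_
      split_ifs with h
      exacts [hg1 _ h, hg2 _ h]
    rw [Set.mem_ofPred_eq, this, Finset.prod_ite, Finset.prod_const, Finset.prod_const]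
    have h2 := Finset.card_filter_add_card_filter_not (s := (Finset.univ : Finset (Fin k)))
      (fun j => B < |z (e j)|)
    rw [Finset.card_univ, Fintype.card_fin] at h2
    set a := (Finset.univ.filter fun j => B < |z (e j)|).card
    set b := (Finset.univ.filter fun j => ¬ B < |z (e j)|).card
    rw [one_div, inv_pow, ← div_eq_mul_inv, le_div_iff₀ (by positivity), one_mul]
    refine pow_le_pow_right₀ ?_ (by omega)
    rw [Real.one_le_sqrt]; norm_num
  calc (Measure.pi (fun _ : Fin n => ρ)).real {z | B < |median (fun i => z (e i))|}
      ≤ (Measure.pi (fun _ : Fin n => ρ)).real {z | 1 ≤ ∏ i, g (z (e i))} :=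
        measureReal_mono hsub
    _ = 1 * (Measure.pi (fun _ : Fin n => ρ)).real {z | 1 ≤ ∏ i, g (z (e i))} := (one_mul _).symm
    _ ≤ ∫ z, ∏ i, g (z (e i)) ∂(Measure.pi (fun _ : Fin n => ρ)) :=
        mul_meas_ge_le_integral_of_nonneg
          (ae_of_all _ fun z => Finset.prod_nonneg fun i _ => (hgpos _).le) hFi 1
    _ = (∫ y, g y ∂ρ) ^ k := hFint
    _ ≤ (Real.sqrt 3 / 2) ^ k := by
        refine pow_le_pow_left₀ (integral_nonneg fun y => (hgpos y).le) hgint k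

/-- Extension of a finite sequence by `0`. -/
def extendZero {n : ℕ} (z : Fin n → ℝ) (i : ℕ) : ℝ := if h : i < n then z ⟨i, h⟩ else 0

/-- The median of the `j`-th block of length `k`. -/
noncomputable def blockMedian (k : ℕ) (v : ℕ → ℝ) (j : ℕ) : ℝ :=
  median (fun i : Fin k => v (j * k + (i : ℕ)))

/-- The samples for which the medians of the first `K` blocks are at most `B` in absolute value. -/
def boundedMedians (n k K : ℕ) (B : ℝ) : Set (Fin n → ℝ) :=
  {z | ∀ j < K, |blockMedian k (extendZero z) j| ≤ B}

lemma measurable_extendZero {n : ℕ} (i : ℕ) :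
    Measurable (fun z : Fin n → ℝ => extendZero z i) := by
  by_cases h : i < n
  · simp only [extendZero, dif_pos h]; exact measurable_pi_apply _
  · simp only [extendZero, dif_neg h]; exact measurable_const

lemma measurable_blockMedian {n k : ℕ} (j : ℕ) :
    Measurable (fun z : Fin n → ℝ => blockMedian k (extendZero z) j) :=
  measurable_median.comp (measurable_pi_lambda _ fun _ => measurable_extendZero _)

lemma measurableSet_boundedMedians (n k K : ℕ) (B : ℝ) :
    MeasurableSet (boundedMedians n k K B) := by
  have : boundedMedians n k K B
      = ⋂ j ∈ Finset.range K, {z | |blockMedian k (extendZero z) j| ≤ B} := by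
    ext z; simp [boundedMedians]
  rw [this]
  exact Finset.measurableSet_biInter _ fun j _ =>
    measurableSet_le (measurable_abs.comp (measurable_blockMedian j)) measurable_const

/-- Union bound over the blocks; `hn` keeps every block clear of the zero padding. -/
lemma one_sub_le_measureReal_boundedMedians (ρ : Measure ℝ) [IsProbabilityMeasure ρ] {B : ℝ}
    (hq : ρ.real {z : ℝ | B < |z|} ≤ 1 / 4) {n k K : ℕ} (hn : K * k ≤ n) :
    1 - K * (Real.sqrt 3 / 2) ^ k
      ≤ (Measure.pi (fun _ : Fin n => ρ)).real (boundedMedians n k K B) := by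
  have h1 : (boundedMedians n k K B)ᶜ
      ⊆ ⋃ j ∈ Finset.range K, {z | B < |blockMedian k (extendZero z) j|} := by
    intro z hz
    simp only [boundedMedians, Set.mem_compl_iff, Set.mem_ofPred_eq, not_forall, not_le] at hz
    obtain ⟨j, hj, h⟩ := hz
    simp only [Set.mem_iUnion, Finset.mem_range]
    exact ⟨j, hj, h⟩
  have h2 : ∀ j ∈ Finset.range K, (Measure.pi (fun _ : Fin n => ρ)).real
      {z | B < |blockMedian k (extendZero z) j|} ≤ (Real.sqrt 3 / 2) ^ k := by
    intro j hj
    have hlt : ∀ i : Fin k, j * k + (i : ℕ) < n := by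
      intro i
      have : (j + 1) * k ≤ K * k := Nat.mul_le_mul_right _ (Finset.mem_range.1 hj)
      have := i.2
      nlinarith
    let e : Fin k ↪ Fin n := ⟨fun i => ⟨j * k + i, hlt i⟩, fun i i' h => by
      simp only [Fin.mk.injEq] at h; exact Fin.ext (by omega)⟩
    have := measureReal_lt_abs_median_le ρ hq e
    have h : ∀ z : Fin n → ℝ, blockMedian k (extendZero z) j = median (fun i => z (e i)) := by
      intro z
      simp only [blockMedian, extendZero, dif_pos (hlt _)]; rfl
    simpa only [h] using this
  have h3 := (measureReal_mono h1 (measure_ne_top _ _)).trans (measureReal_biUnion_finset_le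
    (μ := Measure.pi (fun _ : Fin n => ρ)) (Finset.range K)
    (fun j => {z | B < |blockMedian k (extendZero z) j|}))
  have h4 := h3.trans (Finset.sum_le_sum h2)
  rw [measureReal_compl (measurableSet_boundedMedians n k K B)] at h4
  simp only [probReal_univ, Finset.sum_const, Finset.card_range, nsmul_eq_mul] at h4
  linarith

/-- Flip the signs of the samples in the block `J`. -/
def flipBlock {n : ℕ} (k J : ℕ) (z : Fin n → ℝ) : Fin n → ℝ :=
  fun l => (if (l : ℕ) / k = J then (fun y : ℝ => -y) else id) (z l)

lemma measurePreserving_flipBlock {ρ : Measure ℝ} [IsProbabilityMeasure ρ] (hρ : IsSymmetricLaw ρ)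
    (n k J : ℕ) : MeasurePreserving (flipBlock (n := n) k J)
      (Measure.pi (fun _ : Fin n => ρ)) (Measure.pi (fun _ : Fin n => ρ)) := by
  refine measurePreserving_pi (fun _ : Fin n => ρ) (fun _ : Fin n => ρ)
    (f := fun l => if (l : ℕ) / k = J then (fun y : ℝ => -y) else id) fun l => ?_
  split_ifs
  · exact ⟨measurable_neg, hρ⟩
  · exact MeasurePreserving.id _

lemma blockMedian_flipBlock {n k : ℕ} (J j : ℕ) (z : Fin n → ℝ) :
    blockMedian k (extendZero (flipBlock k J z)) j
      = if j = J then -blockMedian k (extendZero z) j else blockMedian k (extendZero z) j := by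
  have hdiv : ∀ i : Fin k, (j * k + (i : ℕ)) / k = j := by
    intro i
    have hk : 0 < k := i.pos
    rw [mul_comm, Nat.mul_add_div hk, Nat.div_eq_of_lt i.2, add_zero]
  split_ifs with h
  · rw [blockMedian, blockMedian, ← median_neg]
    congr 1; ext i
    simp only [extendZero, flipBlock, hdiv, if_pos h, Pi.neg_apply]
    split_ifs <;> simp
  · rw [blockMedian, blockMedian]
    congr 1; ext i
    simp only [extendZero, flipBlock, hdiv, if_neg h, id]

/-- The event depends on the absolute values of the medians only; this is why symmetry survives the
restriction to it. -/
lemma flipBlock_mem_boundedMedians {n k K : ℕ} {B : ℝ} (J : ℕ) (z : Fin n → ℝ) :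
    flipBlock k J z ∈ boundedMedians n k K B ↔ z ∈ boundedMedians n k K B := by
  have : ∀ j, |blockMedian k (extendZero (flipBlock k J z)) j|
      = |blockMedian k (extendZero z) j| := by
    intro j; rw [blockMedian_flipBlock]; split_ifs <;> simp
  simp only [boundedMedians, Set.mem_ofPred_eq, this]

/-- The sum of the block medians of symmetric samples is sub-Gaussian on the event that the
block medians are bounded. -/
lemma setLIntegral_exp_sum_blockMedian_le {ρ : Measure ℝ} [IsProbabilityMeasure ρ]
    (hρ : IsSymmetricLaw ρ) {n k K : ℕ} {B : ℝ} (c : ℝ) :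
    ∫⁻ z in boundedMedians n k K B,
        ENNReal.ofReal (Real.exp (c * ∑ j ∈ Finset.range K, blockMedian k (extendZero z) j))
          ∂(Measure.pi (fun _ : Fin n => ρ))
      ≤ ENNReal.ofReal (Real.exp (K * (c ^ 2 * B ^ 2 / 2)))
        * Measure.pi (fun _ : Fin n => ρ) (boundedMedians n k K B) := by
  set μ := Measure.pi (fun _ : Fin n => ρ)
  set G := boundedMedians n k K B with hG
  have hGm : MeasurableSet G := measurableSet_boundedMedians n k K B
  -- The induction adds one block at a time while `G` stays the event for all `K` blocks.
  -- Independence of the medians given `G` is never needed, only invariance under flips.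
  have key : ∀ J ≤ K, ∫⁻ z in G,
      ENNReal.ofReal (Real.exp (c * ∑ j ∈ Finset.range J, blockMedian k (extendZero z) j)) ∂μ
      ≤ ENNReal.ofReal (Real.exp (J * (c ^ 2 * B ^ 2 / 2))) * μ G := by
    intro J
    induction J with
    | zero => simp
    | succ J ih =>
      intro hJ
      have hm : ∀ J, Measurable fun z : Fin n → ℝ =>
          ∑ j ∈ Finset.range J, blockMedian k (extendZero z) j := fun J =>
        Finset.measurable_sum _ fun j _ => measurable_blockMedian j
      let A : (Fin n → ℝ) → ENNReal := fun z =>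
        ENNReal.ofReal (Real.exp (c * ∑ j ∈ Finset.range J, blockMedian k (extendZero z) j))
      have hA : Measurable A := ((hm J).const_mul c).exp.ennreal_ofReal
      have hE : ∀ s : ℝ, Measurable fun z : Fin n → ℝ =>
          A z * ENNReal.ofReal (Real.exp (s * blockMedian k (extendZero z) J)) := fun s =>
        hA.mul ((measurable_blockMedian J).const_mul s).exp.ennreal_ofReal
      have hsplit : ∀ z : Fin n → ℝ, ENNReal.ofReal
          (Real.exp (c * ∑ j ∈ Finset.range (J + 1), blockMedian k (extendZero z) j))
          = A z * ENNReal.ofReal (Real.exp (c * blockMedian k (extendZero z) J)) := by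
        intro z
        rw [← ENNReal.ofReal_mul (Real.exp_pos _).le, ← Real.exp_add, Finset.sum_range_succ,
          mul_add]
      have hflip : ∫⁻ z in G, A z * ENNReal.ofReal
            (Real.exp (c * blockMedian k (extendZero z) J)) ∂μ
          = ∫⁻ z in G, A z * ENNReal.ofReal
            (Real.exp ((-c) * blockMedian k (extendZero z) J)) ∂μ := by
        rw [← lintegral_indicator hGm, ← lintegral_indicator hGm,
          ← (measurePreserving_flipBlock hρ n k J).lintegral_comp ((hE c).indicator hGm)]
        refine lintegral_congr fun z => ?_
        have hAz : A (flipBlock k J z) = A z := by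
          simp only [A]
          congr 3
          refine Finset.sum_congr rfl fun j hj => ?_
          rw [blockMedian_flipBlock, if_neg (Finset.mem_range.1 hj).ne]
        by_cases hz : z ∈ G
        · rw [Set.indicator_of_mem hz,
            Set.indicator_of_mem ((flipBlock_mem_boundedMedians J z).2 hz), hAz,
            blockMedian_flipBlock, if_pos rfl, mul_neg, neg_mul]
        · rw [Set.indicator_of_notMem hz,
            Set.indicator_of_notMem (mt (flipBlock_mem_boundedMedians J z).1 hz)]
      -- Adding the integral to its flipped copy produces `2 cosh`, and `cosh x ≤ exp (x ^ 2 / 2)`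
      -- with the median bounded by `B` on `G`.
      have hsum : 2 * ∫⁻ z in G, A z * ENNReal.ofReal
            (Real.exp (c * blockMedian k (extendZero z) J)) ∂μ
          ≤ 2 * (ENNReal.ofReal (Real.exp (c ^ 2 * B ^ 2 / 2)) * ∫⁻ z in G, A z ∂μ) := by
        rw [two_mul]
        nth_rw 2 [hflip]
        rw [← lintegral_add_left (hE c), ← lintegral_const_mul _ hA, ← lintegral_const_mul _
          (hA.const_mul _)]
        refine setLIntegral_mono (((hA.const_mul _)).const_mul _) fun z hz => ?_
        rw [← mul_add, ← ENNReal.ofReal_add (Real.exp_pos _).le (Real.exp_pos _).le,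
          mul_comm (A z), ← mul_assoc]
        refine mul_le_mul_left ?_ _
        rw [show (2 : ENNReal) = ENNReal.ofReal 2 by simp, ← ENNReal.ofReal_mul (by norm_num)]
        refine ENNReal.ofReal_le_ofReal ?_
        have h1 := Real.cosh_le_exp_half_sq (c * blockMedian k (extendZero z) J)
        rw [Real.cosh_eq] at h1
        have h2 : (c * blockMedian k (extendZero z) J) ^ 2 ≤ c ^ 2 * B ^ 2 := by
          rw [mul_pow]
          refine mul_le_mul_of_nonneg_left ?_ (sq_nonneg c)
          rw [← sq_abs]
          exact pow_le_pow_left₀ (abs_nonneg _) (hz J (by omega)) 2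
        have h3 : Real.exp ((c * blockMedian k (extendZero z) J) ^ 2 / 2)
            ≤ Real.exp (c ^ 2 * B ^ 2 / 2) := Real.exp_le_exp.2 (by linarith)
        rw [neg_mul]
        linarith
      have hsum' := (ENNReal.mul_le_mul_iff_right (by norm_num) (by norm_num)).1 hsum
      simp only [hsplit]
      refine hsum'.trans ?_
      refine (mul_le_mul_right (ih (by omega)) _).trans ?_
      rw [← mul_assoc, ← ENNReal.ofReal_mul (Real.exp_pos _).le, ← Real.exp_add]
      gcongr
      apply le_of_eq; push_cast; ring
  exact key K le_rfl

/-! ### The law of the noise of several pulls of the same arm -/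

/-- The law of `n` independent noises of the same arm. -/
noncomputable def roundKernel {d : ℕ} (ν : Kernel (Vec d) ℝ) [IsMarkovKernel ν] (n : ℕ) :
    Kernel (Vec d) (Fin n → ℝ) where
  toFun x := Measure.pi (fun _ => ν x)
  measurable' := by
    refine Measurable.measure_of_isPiSystem_of_isProbabilityMeasure generateFrom_pi.symm
      isPiSystem_pi ?_
    rintro _ ⟨B, hB, rfl⟩
    simp only [Measure.pi_pi]
    exact Finset.measurable_prod _ fun i _ => ν.measurable_coe (hB i (Set.mem_univ i))

instance {d : ℕ} (ν : Kernel (Vec d) ℝ) [IsMarkovKernel ν] (n : ℕ) :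
    IsMarkovKernel (roundKernel ν n) :=
  ⟨fun x => by
    change IsProbabilityMeasure (Measure.pi (fun _ : Fin n => ν x)); infer_instance⟩

lemma roundKernel_apply {d : ℕ} (ν : Kernel (Vec d) ℝ) [IsMarkovKernel ν] (n : ℕ) (x : Vec d) :
    roundKernel ν n x = Measure.pi (fun _ => ν x) := rfl

/-- The noises of the `n` pulls from pull `i` on. -/
noncomputable def noiseVector {d : ℕ} {Ω : Type*} (θ : Vec d) (a : ℕ → Ω → Vec d) (r : ℕ → Ω → ℝ) (n i : ℕ)
    (ω : Ω) : Fin n → ℝ :=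
  fun j => r (i + j) ω - ⟪θ, a (i + j) ω⟫_ℝ

section

variable {d : ℕ} {Ω : Type*} [mΩ : MeasurableSpace Ω] {P : Measure Ω}
  {ℱ : Filtration ℕ mΩ} {θ : Vec d} {ν : Kernel (Vec d) ℝ}
  {a : ℕ → Ω → Vec d} {r : ℕ → Ω → ℝ}

lemma IsInteraction.measurable_noise (h : IsInteraction P ℱ θ ν a r) {i j : ℕ} (hij : i < j) :
    Measurable[ℱ j] (fun ω => r i ω - ⟪θ, a i ω⟫_ℝ) := by
  have h1 : Measurable[ℱ j] (r i) := (h.measurable_reward i).mono (ℱ.mono hij) le_rfl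
  have h2 : Measurable[ℱ j] (a i) := (h.measurable_arm i).mono (ℱ.mono hij.le) le_rfl
  exact h1.sub ((measurable_const.inner measurable_id).comp h2)

lemma IsInteraction.measurable_noiseVector (h : IsInteraction P ℱ θ ν a r) (n i : ℕ) :
    Measurable[ℱ (i + n)] (noiseVector θ a r n i) :=
  @measurable_pi_lambda _ _ _ (ℱ (i + n)) _ _ fun j => h.measurable_noise (by omega)

/-- `noise_law` says that two measures agree after trimming to `ℱ i`; hence they integrate every `ℱ
i`-measurable function alike. -/
lemma IsInteraction.lintegral_mul_indicator (h : IsInteraction P ℱ θ ν a r) (i : ℕ)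
    {g : Ω → ENNReal} (hg : Measurable[ℱ i] g) {B : Set ℝ} (hB : MeasurableSet B) :
    ∫⁻ ω, g ω * {ω | r i ω - ⟪θ, a i ω⟫_ℝ ∈ B}.indicator 1 ω ∂P
      = ∫⁻ ω, g ω * ν (a i ω) B ∂P := by
  have hE : MeasurableSet {ω | r i ω - ⟪θ, a i ω⟫_ℝ ∈ B} :=
    ((h.measurable_noise (Nat.lt_succ_self i)).mono (ℱ.le _) le_rfl) hB
  have hν : Measurable fun ω => ν (a i ω) B :=
    (ν.measurable_coe hB).comp ((h.measurable_arm i).mono (ℱ.le _) le_rfl)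
  have hg' : Measurable g := hg.mono (ℱ.le _) le_rfl
  have key : (P.restrict {ω | r i ω - ⟪θ, a i ω⟫_ℝ ∈ B}).trim (ℱ.le i)
      = (P.withDensity fun ω => ν (a i ω) B).trim (ℱ.le i) := by
    refine @Measure.ext _ (ℱ i) _ _ fun A hA => ?_
    rw [trim_measurableSet_eq _ hA, trim_measurableSet_eq _ hA, Measure.restrict_apply
      (ℱ.le i _ hA), withDensity_apply _ (ℱ.le i _ hA)]
    exact h.noise_law i A B hA hB
  have h1 := lintegral_trim (ℱ.le i) (μ := P.restrict {ω | r i ω - ⟪θ, a i ω⟫_ℝ ∈ B}) hg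
  rw [key, lintegral_trim (ℱ.le i) hg, lintegral_withDensity_eq_lintegral_mul _ hν hg'] at h1
  simp only [Pi.mul_apply] at h1
  simp only [mul_comm (g _)]
  rw [h1, ← lintegral_indicator hE]
  refine lintegral_congr fun ω => ?_
  by_cases hω : ω ∈ {ω | r i ω - ⟪θ, a i ω⟫_ℝ ∈ B}
  · simp [Set.indicator_of_mem hω]
  · simp [Set.indicator_of_notMem hω]

/-- The last pull is integrated out first. As the arm is constant through the round, the resulting
factor is already `ℱ i`-measurable and is absorbed into `g`, which is why `g` is general. -/
lemma IsInteraction.lintegral_mul_prod_indicator (h : IsInteraction P ℱ θ ν a r) (i : ℕ)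
    {B : ℕ → Set ℝ} (hB : ∀ j, MeasurableSet (B j)) (n : ℕ)
    (ha : ∀ᵐ ω ∂P, ∀ j < n, a (i + j) ω = a i ω) {g : Ω → ENNReal} (hg : Measurable[ℱ i] g) :
    ∫⁻ ω, g ω * ∏ j ∈ Finset.range n,
        {ω | r (i + j) ω - ⟪θ, a (i + j) ω⟫_ℝ ∈ B j}.indicator 1 ω ∂P
      = ∫⁻ ω, g ω * ∏ j ∈ Finset.range n, ν (a i ω) (B j) ∂P := by
  induction n generalizing g with
  | zero => simp
  | succ n ih =>
    have hν : Measurable[ℱ i] fun ω => ν (a i ω) (B n) :=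
      (ν.measurable_coe (hB n)).comp (h.measurable_arm i)
    have hind : ∀ j ∈ Finset.range n, Measurable[ℱ (i + n)]
        ({ω | r (i + j) ω - ⟪θ, a (i + j) ω⟫_ℝ ∈ B j}.indicator (1 : Ω → ENNReal)) := by
      intro j hj
      refine (@measurable_one _ _ _ (ℱ (i + n)) _).indicator ?_
      exact h.measurable_noise (by have := Finset.mem_range.1 hj; omega) (hB j)
    have hm : Measurable[ℱ (i + n)] fun ω => g ω * ∏ j ∈ Finset.range n,
        {ω | r (i + j) ω - ⟪θ, a (i + j) ω⟫_ℝ ∈ B j}.indicator (1 : Ω → ENNReal) ω :=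
      (hg.mono (ℱ.mono (by omega)) le_rfl).mul (Finset.measurable_fun_prod _ hind)
    simp only [Finset.prod_range_succ, ← mul_assoc]
    rw [h.lintegral_mul_indicator (i + n) hm (hB n)]
    have h1 : ∫⁻ ω, g ω * (∏ j ∈ Finset.range n,
          {ω | r (i + j) ω - ⟪θ, a (i + j) ω⟫_ℝ ∈ B j}.indicator 1 ω) * ν (a (i + n) ω) (B n) ∂P
        = ∫⁻ ω, (g ω * ν (a i ω) (B n)) * ∏ j ∈ Finset.range n,
          {ω | r (i + j) ω - ⟪θ, a (i + j) ω⟫_ℝ ∈ B j}.indicator 1 ω ∂P := by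
      refine lintegral_congr_ae (ha.mono fun ω hω => ?_)
      simp only [hω n (Nat.lt_succ_self n)]
      ring
    rw [h1, ih (ha.mono fun ω hω j hj => hω j (by omega))
      (g := fun ω => g ω * ν (a i ω) (B n)) (hg.mul hν)]
    refine lintegral_congr fun ω => ?_
    ring

variable [IsProbabilityMeasure P] [IsMarkovKernel ν]

/-- Given the past, the noises of `n` pulls of the same arm are independent with the noise law of
that arm. -/
lemma IsInteraction.lintegral_noiseVector (h : IsInteraction P ℱ θ ν a r) (i n : ℕ)
    (ha : ∀ᵐ ω ∂P, ∀ j < n, a (i + j) ω = a i ω) {E : Type*} [MeasurableSpace E] {p : Ω → E}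
    (hp : Measurable[ℱ i] p) {F : E × (Fin n → ℝ) → ENNReal} (hF : Measurable F) :
    ∫⁻ ω, F (p ω, noiseVector θ a r n i ω) ∂P
      = ∫⁻ ω, ∫⁻ z, F (p ω, z) ∂(roundKernel ν n (a i ω)) ∂P := by
  have hp' : Measurable p := hp.mono (ℱ.le _) le_rfl
  have ha' : Measurable (a i) := (h.measurable_arm i).mono (ℱ.le _) le_rfl
  have hz : Measurable (noiseVector θ a r n i) :=
    (h.measurable_noiseVector n i).mono (ℱ.le _) le_rfl
  have hκ : Measurable fun ω => roundKernel ν n (a i ω) := (roundKernel ν n).measurable.comp ha'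
  let κ : Kernel (E × Vec d) (Fin n → ℝ) := (roundKernel ν n).comap Prod.snd measurable_snd
  -- The joint law of the past and the noise vector is a composition product. It suffices to test
  -- rectangles, and for a fixed past event, boxes of noises.
  have key : P.map (fun ω => ((p ω, a i ω), noiseVector θ a r n i ω))
      = (P.map fun ω => (p ω, a i ω)) ⊗ₘ κ := by
    have : IsProbabilityMeasure (P.map fun ω => (p ω, a i ω)) :=
      Measure.isProbabilityMeasure_map (hp'.prodMk ha').aemeasurable
    have : IsProbabilityMeasure (P.map fun ω => ((p ω, a i ω), noiseVector θ a r n i ω)) :=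
      Measure.isProbabilityMeasure_map ((hp'.prodMk ha').prodMk hz).aemeasurable
    refine Measure.ext_prod fun {s t} hs ht => ?_
    have hs' : MeasurableSet ((fun ω => (p ω, a i ω)) ⁻¹' s) := (hp'.prodMk ha') hs
    have hsi : MeasurableSet[ℱ i] ((fun ω => (p ω, a i ω)) ⁻¹' s) :=
      (hp.prodMk (h.measurable_arm i)) hs
    have hRHS : ∀ t, MeasurableSet t → ((P.map fun ω => (p ω, a i ω)) ⊗ₘ κ) (s ×ˢ t)
        = ((P.restrict ((fun ω => (p ω, a i ω)) ⁻¹' s)).bind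
            fun ω => roundKernel ν n (a i ω)) t := by
      intro t ht
      rw [Measure.compProd_apply_prod hs ht, setLIntegral_map hs (κ.measurable_coe ht)
        (hp'.prodMk ha'), Measure.bind_apply ht hκ.aemeasurable]
      rfl
    have hLHS : ∀ t, MeasurableSet t →
        (P.map fun ω => ((p ω, a i ω), noiseVector θ a r n i ω)) (s ×ˢ t)
        = ((P.restrict ((fun ω => (p ω, a i ω)) ⁻¹' s)).map (noiseVector θ a r n i)) t := by
      intro t ht
      rw [Measure.map_apply ((hp'.prodMk ha').prodMk hz) (hs.prod ht), Measure.map_apply hz ht,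
        Measure.restrict_apply (hz ht)]
      congr 1
      ext ω; simp [and_comm]
    rw [hRHS t ht, hLHS t ht]
    congr 1
    refine ext_of_generate_finite _ generateFrom_pi.symm isPiSystem_pi ?_ ?_
    · rintro _ ⟨B, hB, rfl⟩
      have hB' : ∀ j, MeasurableSet (B j) := fun j => hB j (Set.mem_univ j)
      have hBm : MeasurableSet (Set.univ.pi B) := MeasurableSet.univ_pi hB'
      rw [Measure.map_apply hz hBm, Measure.bind_apply hBm hκ.aemeasurable, Measure.restrict_apply (hz hBm)]
      let B' : ℕ → Set ℝ := fun j => if hj : j < n then B ⟨j, hj⟩ else Set.univ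
      have hB'm : ∀ j, MeasurableSet (B' j) := by
        intro j; simp only [B']; split_ifs
        exacts [hB' _, MeasurableSet.univ]
      have hB'e : ∀ j : Fin n, B' j = B j := by intro j; simp [B']
      have h1 := h.lintegral_mul_prod_indicator i hB'm n ha
        (g := ((fun ω => (p ω, a i ω)) ⁻¹' s).indicator 1)
        ((@measurable_one _ _ _ (ℱ i) _).indicator hsi)
      simp only [← Fin.prod_univ_eq_prod_range
        (fun j => {ω | r (i + j) ω - ⟪θ, a (i + j) ω⟫_ℝ ∈ B' j}.indicator (1 : Ω → ENNReal) _),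
        ← Fin.prod_univ_eq_prod_range (fun j => ν _ (B' j)), hB'e] at h1
      rw [← lintegral_indicator hs', ← lintegral_indicator_one ((hz hBm).inter hs')]
      trans ∫⁻ ω, ((fun ω => (p ω, a i ω)) ⁻¹' s).indicator (1 : Ω → ENNReal) ω
        * ∏ j : Fin n, ν (a i ω) (B j) ∂P
      · rw [← h1]
        refine lintegral_congr fun ω => ?_
        rw [Set.inter_comm, Set.inter_indicator_one, Pi.mul_apply]
        congr 1
        by_cases hω : ∀ j : Fin n, r (i + j) ω - ⟪θ, a (i + j) ω⟫_ℝ ∈ B j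
        · rw [Set.indicator_of_mem (by
            simpa [noiseVector] using hω), Finset.prod_eq_one]
          · rfl
          · intro j _; exact Set.indicator_of_mem (s := {ω : Ω | r (i + j) ω - ⟪θ, a (i + j) ω⟫_ℝ ∈ B j}) (hω j) (1 : Ω → ENNReal)
        · rw [Set.indicator_of_notMem (by simpa [noiseVector] using hω)]
          push Not at hω
          obtain ⟨j, hj⟩ := hω
          rw [Finset.prod_eq_zero (Finset.mem_univ j) 
            (Set.indicator_of_notMem (s := {ω : Ω | r (i + j) ω - ⟪θ, a (i + j) ω⟫_ℝ ∈ B j})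
              hj (1 : Ω → ENNReal))]
      · refine lintegral_congr fun ω => ?_
        by_cases hω : ω ∈ (fun ω => (p ω, a i ω)) ⁻¹' s
        · rw [Set.indicator_of_mem hω, Set.indicator_of_mem hω, roundKernel_apply, Measure.pi_pi]
          simp
        · rw [Set.indicator_of_notMem hω, Set.indicator_of_notMem hω, zero_mul]
    · rw [Measure.map_apply hz MeasurableSet.univ, Measure.bind_apply MeasurableSet.univ
        hκ.aemeasurable]
      simp
  have hF' : Measurable fun q : (E × Vec d) × (Fin n → ℝ) => F (q.1.1, q.2) := by fun_prop
  calc ∫⁻ ω, F (p ω, noiseVector θ a r n i ω) ∂P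
      = ∫⁻ q, F (q.1.1, q.2) ∂(P.map fun ω => ((p ω, a i ω), noiseVector θ a r n i ω)) := by
        rw [lintegral_map hF' ((hp'.prodMk ha').prodMk hz)]
    _ = ∫⁻ ω, ∫⁻ z, F (p ω, z) ∂(roundKernel ν n (a i ω)) ∂P := by
        rw [key, Measure.lintegral_compProd hF',
          lintegral_map hF'.lintegral_kernel_prod_right' (hp'.prodMk ha')]
        rfl

end

/-! ### Positive definite matrices and rank-one updates -/

section

variable {d : ℕ} {V : Matrix (Fin d) (Fin d) ℝ}

lemma dotProduct_mulVec_nonneg (hV : V.PosDef) (u : Fin d → ℝ) : 0 ≤ u ⬝ᵥ (V *ᵥ u) := by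
  simpa using hV.posSemidef.dotProduct_mulVec_nonneg u

lemma dotProduct_mulVec_swap (hV : V.PosDef) (u v : Fin d → ℝ) :
    u ⬝ᵥ (V *ᵥ v) = v ⬝ᵥ (V *ᵥ u) := by
  have h : Vᵀ = V := by simpa using hV.isHermitian.eq
  rw [Matrix.dotProduct_mulVec, ← Matrix.mulVec_transpose, h, dotProduct_comm]

lemma mulVec_inv_mulVec (hV : V.PosDef) (u : Fin d → ℝ) : V *ᵥ (V⁻¹ *ᵥ u) = u := by
  rw [Matrix.mulVec_mulVec, Matrix.mul_nonsing_inv _ hV.det_pos.ne'.isUnit, Matrix.one_mulVec]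

lemma inv_mulVec_mulVec (hV : V.PosDef) (u : Fin d → ℝ) : V⁻¹ *ᵥ (V *ᵥ u) = u := by
  rw [Matrix.mulVec_mulVec, Matrix.nonsing_inv_mul _ hV.det_pos.ne'.isUnit, Matrix.one_mulVec]

/-- Cauchy–Schwarz for the form `V`, from the discriminant of the nonnegative quadratic given by `u
+ s • v`. -/
lemma dotProduct_mulVec_sq_le (hV : V.PosDef) (u v : Fin d → ℝ) :
    (u ⬝ᵥ (V *ᵥ v)) ^ 2 ≤ (u ⬝ᵥ (V *ᵥ u)) * (v ⬝ᵥ (V *ᵥ v)) := by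
  have key : ∀ s : ℝ, 0 ≤ (v ⬝ᵥ (V *ᵥ v)) * (s * s) + (2 * (u ⬝ᵥ (V *ᵥ v))) * s
      + u ⬝ᵥ (V *ᵥ u) := by
    intro s
    have h := dotProduct_mulVec_nonneg hV (u + s • v)
    simp only [Matrix.mulVec_add, Matrix.mulVec_smul, add_dotProduct, dotProduct_add,
      smul_dotProduct, dotProduct_smul, smul_eq_mul] at h
    rw [dotProduct_mulVec_swap hV v u] at h
    linarith
  have := discrim_le_zero key
  rw [discrim] at this
  linarith

/-- Duality of the norms of `V⁻¹` and `V`: Cauchy–Schwarz for `V⁻¹ u` and `v`. -/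
lemma dotProduct_sq_le (hV : V.PosDef) (u v : Fin d → ℝ) :
    (u ⬝ᵥ v) ^ 2 ≤ (u ⬝ᵥ (V⁻¹ *ᵥ u)) * (v ⬝ᵥ (V *ᵥ v)) := by
  have h := dotProduct_mulVec_sq_le hV (V⁻¹ *ᵥ u) v
  rwa [dotProduct_mulVec_swap hV, mulVec_inv_mulVec hV, dotProduct_comm v,
    dotProduct_comm (V⁻¹ *ᵥ u)] at h

lemma weightedNorm_sub_le (hV : V.PosDef) (u v : Fin d → ℝ) :
    weightedNorm V (u - v) ≤ weightedNorm V u + weightedNorm V v := by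
  have hu := dotProduct_mulVec_nonneg hV u
  have hv := dotProduct_mulVec_nonneg hV v
  have h := dotProduct_mulVec_sq_le hV u v
  rw [weightedNorm, weightedNorm, weightedNorm, Real.sqrt_le_left (by positivity)]
  have h1 : |u ⬝ᵥ (V *ᵥ v)| ≤ Real.sqrt (u ⬝ᵥ (V *ᵥ u)) * Real.sqrt (v ⬝ᵥ (V *ᵥ v)) := by
    rw [← Real.sqrt_mul hu]
    exact Real.abs_le_sqrt h
  have h2 := neg_le_of_abs_le h1
  simp only [Matrix.mulVec_sub, sub_dotProduct, dotProduct_sub]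
  rw [dotProduct_mulVec_swap hV v u, add_sq, Real.sq_sqrt hu, Real.sq_sqrt hv]
  linarith

lemma posDef_add_vecMulVec (hV : V.PosDef) (x : Fin d → ℝ) :
    (V + Matrix.vecMulVec x x).PosDef := by
  have := Matrix.posSemidef_vecMulVec_self_star x
  rw [star_trivial] at this
  exact hV.add_posSemidef this

lemma one_add_dotProduct_inv_pos (hV : V.PosDef) (x : Fin d → ℝ) :
    0 < 1 + x ⬝ᵥ (V⁻¹ *ᵥ x) := by
  have := dotProduct_mulVec_nonneg hV.inv x
  linarith

lemma det_add_vecMulVec (hV : V.PosDef) (x : Fin d → ℝ) :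
    (V + Matrix.vecMulVec x x).det = V.det * (1 + x ⬝ᵥ (V⁻¹ *ᵥ x)) := by
  have h := Matrix.det_add_replicateCol_mul_replicateRow (ι := Unit) hV.det_pos.ne'.isUnit x x
  rw [← Matrix.vecMulVec_eq] at h
  rw [h]
  congr 2
  rw [Matrix.det_unique, Matrix.mul_assoc, ← Matrix.replicateCol_mulVec, Matrix.add_apply,
    Matrix.one_apply_eq, Matrix.replicateRow_mul_replicateCol_apply]

/-- Sherman–Morrison formula, checked by applying the updated matrix to the right-hand side. -/
lemma inv_add_vecMulVec_mulVec (hV : V.PosDef) (x u : Fin d → ℝ) :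
    (V + Matrix.vecMulVec x x)⁻¹ *ᵥ u
      = V⁻¹ *ᵥ u - ((x ⬝ᵥ (V⁻¹ *ᵥ u)) / (1 + x ⬝ᵥ (V⁻¹ *ᵥ x))) • (V⁻¹ *ᵥ x) := by
  have hV' := posDef_add_vecMulVec hV x
  have hw := (one_add_dotProduct_inv_pos hV x).ne'
  have h : (V + Matrix.vecMulVec x x) *ᵥ (V⁻¹ *ᵥ u
      - ((x ⬝ᵥ (V⁻¹ *ᵥ u)) / (1 + x ⬝ᵥ (V⁻¹ *ᵥ x))) • (V⁻¹ *ᵥ x)) = u := by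
    rw [Matrix.mulVec_sub, Matrix.mulVec_smul, Matrix.add_mulVec, Matrix.add_mulVec,
      mulVec_inv_mulVec hV, mulVec_inv_mulVec hV, Matrix.vecMulVec_mulVec,
      Matrix.vecMulVec_mulVec]
    ext i
    simp
    field_simp
    ring
  nth_rw 1 [← h]
  rw [inv_mulVec_mulVec hV']

/-- The change of `‖S‖²` in the inverse norm under a rank-one update. -/
lemma dotProduct_inv_add_vecMulVec (hV : V.PosDef) (x S : Fin d → ℝ) (η : ℝ) :
    (S + η • x) ⬝ᵥ ((V + Matrix.vecMulVec x x)⁻¹ *ᵥ (S + η • x))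
      = S ⬝ᵥ (V⁻¹ *ᵥ S) + (2 * η * (x ⬝ᵥ (V⁻¹ *ᵥ S)) + η ^ 2 * (x ⬝ᵥ (V⁻¹ *ᵥ x))
        - (x ⬝ᵥ (V⁻¹ *ᵥ S)) ^ 2) / (1 + x ⬝ᵥ (V⁻¹ *ᵥ x)) := by
  have hw := (one_add_dotProduct_inv_pos hV x).ne'
  rw [inv_add_vecMulVec_mulVec hV]
  simp only [Matrix.mulVec_add, Matrix.mulVec_smul, add_dotProduct, dotProduct_add,
    smul_dotProduct, dotProduct_smul, dotProduct_sub, smul_eq_mul]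
  rw [dotProduct_mulVec_swap hV.inv S x]
  field_simp
  ring

/-- AM–GM for the eigenvalues, by summing the tangent bound `log μ ≤ μ / c - 1 + log c`. -/
lemma det_le_pow_of_trace_le (hV : V.PosDef) {c : ℝ} (hc : 0 < c) (h : V.trace ≤ d * c) :
    V.det ≤ c ^ d := by
  have hdet := hV.isHermitian.det_eq_prod_eigenvalues
  have htr := hV.isHermitian.trace_eq_sum_eigenvalues
  simp only [RCLike.ofReal_real_eq_id, id] at hdet htr
  have hpos := hV.eigenvalues_pos
  rw [← Real.log_le_log_iff hV.det_pos (by positivity), hdet,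
    Real.log_prod fun i _ => (hpos i).ne', Real.log_pow]
  have : ∀ i ∈ Finset.univ, Real.log (hV.isHermitian.eigenvalues i)
      ≤ hV.isHermitian.eigenvalues i / c - 1 + Real.log c := by
    intro i _
    have := Real.log_le_sub_one_of_pos (div_pos (hpos i) hc)
    rw [Real.log_div (hpos i).ne' hc.ne'] at this
    linarith
  refine (Finset.sum_le_sum this).trans ?_
  rw [Finset.sum_add_distrib, Finset.sum_sub_distrib, ← Finset.sum_div, ← htr]
  have : V.trace / c ≤ d := by rwa [div_le_iff₀ hc]
  simp
  linarith

end

/-! ### The design matrix and the noise sum of the first rounds -/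

section

variable {d : ℕ}

/-- The regularized design matrix of the first `t` arms of a sequence. -/
noncomputable def gram (lam : ℝ) (y : ℕ → Vec d) (t : ℕ) : Matrix (Fin d) (Fin d) ℝ :=
  lam • (1 : Matrix (Fin d) (Fin d) ℝ)
    + ∑ s ∈ Finset.range t, Matrix.vecMulVec (y s).ofLp (y s).ofLp

/-- The weighted sum `∑ η_s x_s` of the first `t` arms. -/
noncomputable def armSum (y : ℕ → Vec d) (η : ℕ → ℝ) (t : ℕ) : Fin d → ℝ :=
  ∑ s ∈ Finset.range t, η s • (y s).ofLp

lemma gram_zero (lam : ℝ) (y : ℕ → Vec d) : gram lam y 0 = lam • 1 := by simp [gram]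

lemma gram_succ (lam : ℝ) (y : ℕ → Vec d) (t : ℕ) :
    gram lam y (t + 1) = gram lam y t + Matrix.vecMulVec (y t).ofLp (y t).ofLp := by
  simp [gram, Finset.sum_range_succ, add_assoc]

lemma armSum_succ (y : ℕ → Vec d) (η : ℕ → ℝ) (t : ℕ) :
    armSum y η (t + 1) = armSum y η t + η t • (y t).ofLp := by
  simp [armSum, Finset.sum_range_succ]

lemma posDef_gram {lam : ℝ} (hlam : 0 < lam) (y : ℕ → Vec d) (t : ℕ) : (gram lam y t).PosDef := by
  induction t with
  | zero => rw [gram_zero]; exact Matrix.PosDef.one.smul hlam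
  | succ t ih => rw [gram_succ]; exact posDef_add_vecMulVec ih _

lemma designMatrix_eq_gram (lam : ℝ) (y : ℕ → Vec d) (ρ : ℕ → ℝ) (t : ℕ) :
    designMatrix lam (fun s : Fin t => (y s, ρ s)) = gram lam y t := by
  simp only [designMatrix, gram]
  rw [Fin.sum_univ_eq_sum_range (fun s => Matrix.vecMulVec (y s).ofLp (y s).ofLp)]

lemma dotProduct_ofLp_self (x : Vec d) : x.ofLp ⬝ᵥ x.ofLp = ‖x‖ ^ 2 := by
  rw [EuclideanSpace.real_norm_sq_eq, dotProduct]
  simp [pow_two]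

lemma inner_eq_dotProduct (u v : Vec d) : ⟪u, v⟫_ℝ = u.ofLp ⬝ᵥ v.ofLp := by
  rw [EuclideanSpace.inner_eq_star_dotProduct, star_trivial, dotProduct_comm]

lemma gram_mulVec (lam : ℝ) (y : ℕ → Vec d) (t : ℕ) (u : Fin d → ℝ) :
    gram lam y t *ᵥ u = lam • u + armSum y (fun s => (y s).ofLp ⬝ᵥ u) t := by
  induction t with
  | zero => simp [gram_zero, armSum, Matrix.smul_mulVec]
  | succ t ih =>
    rw [gram_succ, Matrix.add_mulVec, ih, armSum_succ, Matrix.vecMulVec_mulVec, add_assoc]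
    congr 2
    ext i; simp [mul_comm]

lemma dotProduct_armSum (y : ℕ → Vec d) (η : ℕ → ℝ) (t : ℕ) (u : Fin d → ℝ) :
    u ⬝ᵥ armSum y η t = ∑ s ∈ Finset.range t, η s * (u ⬝ᵥ (y s).ofLp) := by
  rw [armSum, dotProduct_sum]
  simp

lemma mul_dotProduct_le_gram (lam : ℝ) (y : ℕ → Vec d) (t : ℕ) (u : Fin d → ℝ) :
    lam * (u ⬝ᵥ u) ≤ u ⬝ᵥ (gram lam y t *ᵥ u) := by
  rw [gram_mulVec, dotProduct_add, dotProduct_armSum, dotProduct_smul, smul_eq_mul]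
  have : 0 ≤ ∑ s ∈ Finset.range t, (y s).ofLp ⬝ᵥ u * (u ⬝ᵥ (y s).ofLp) :=
    Finset.sum_nonneg fun s _ => by rw [dotProduct_comm u]; exact mul_self_nonneg _
  linarith

/-- With `w = V⁻¹ u` and `q = u ⬝ w`, the bound `V ≥ lam` gives `lam |w|² ≤ q`, and `q² ≤ |u|²
|w|²`; one factor `q` is then cancelled. -/
lemma dotProduct_gram_inv_le {lam : ℝ} (hlam : 0 < lam) (y : ℕ → Vec d) (t : ℕ) (u : Fin d → ℝ) :
    lam * (u ⬝ᵥ ((gram lam y t)⁻¹ *ᵥ u)) ≤ u ⬝ᵥ u := by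
  have hV := posDef_gram hlam y t
  set q := u ⬝ᵥ ((gram lam y t)⁻¹ *ᵥ u) with hq
  have hq0 : 0 ≤ q := dotProduct_mulVec_nonneg hV.inv u
  have h1 := mul_dotProduct_le_gram lam y t ((gram lam y t)⁻¹ *ᵥ u)
  rw [mulVec_inv_mulVec hV, dotProduct_comm _ u, ← hq] at h1
  have h2 := dotProduct_mulVec_sq_le (V := (1 : Matrix (Fin d) (Fin d) ℝ)) Matrix.PosDef.one u
    ((gram lam y t)⁻¹ *ᵥ u)
  simp only [Matrix.one_mulVec] at h2
  rw [← hq] at h2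
  rcases hq0.eq_or_lt with h0 | h0
  · rw [← h0, mul_zero]
    simpa using dotProduct_mulVec_nonneg (V := (1 : Matrix (Fin d) (Fin d) ℝ)) Matrix.PosDef.one u
  · have h3 : 0 ≤ u ⬝ᵥ u := by
      simpa using dotProduct_mulVec_nonneg (V := (1 : Matrix (Fin d) (Fin d) ℝ))
        Matrix.PosDef.one u
    have h4 := mul_le_mul_of_nonneg_left h1 h3
    have h5 := mul_le_mul_of_nonneg_left h2 hlam.le
    refine le_of_mul_le_mul_right ?_ h0
    nlinarith

lemma det_gram_le {lam : ℝ} (hlam : 0 < lam) {y : ℕ → Vec d} {t : ℕ}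
    (hy : ∀ s < t, ‖y s‖ ≤ 1) : (gram lam y t).det ≤ (lam + t) ^ d := by
  rcases Nat.eq_zero_or_pos d with rfl | hd
  · simp
  refine det_le_pow_of_trace_le (posDef_gram hlam y t) (by positivity) ?_
  rw [gram, Matrix.trace_add, Matrix.trace_smul, Matrix.trace_one, Matrix.trace_sum]
  simp only [Matrix.trace_vecMulVec, dotProduct_ofLp_self]
  have h1 : ∑ s ∈ Finset.range t, ‖y s‖ ^ 2 ≤ t := by
    refine (Finset.sum_le_sum (g := fun _ => (1 : ℝ)) fun s hs => ?_).trans (by simp)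
    exact pow_le_one₀ (norm_nonneg _) (hy s (Finset.mem_range.1 hs))
  have h2 : (t : ℝ) ≤ d * t := le_mul_of_one_le_left (by positivity) (by exact_mod_cast hd)
  simp only [Fintype.card_fin, smul_eq_mul]
  linarith

/-- By the matrix determinant lemma each summand is an increment of `log det`, so the sum
telescopes. -/
lemma sum_log_one_add_eq {lam : ℝ} (hlam : 0 < lam) (y : ℕ → Vec d) (t : ℕ) :
    ∑ s ∈ Finset.range t, Real.log (1 + (y s).ofLp ⬝ᵥ ((gram lam y s)⁻¹ *ᵥ (y s).ofLp))
      = Real.log (gram lam y t).det - Real.log (lam ^ d) := by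
  induction t with
  | zero => simp [gram_zero]
  | succ t ih =>
    rw [Finset.sum_range_succ, ih, gram_succ, det_add_vecMulVec (posDef_gram hlam y t),
      Real.log_mul (posDef_gram hlam y t).det_pos.ne'
        (one_add_dotProduct_inv_pos (posDef_gram hlam y t) _).ne']
    ring

/-- The elliptical potential lemma. -/
lemma sum_min_one_le {lam : ℝ} (hlam : 0 < lam) {y : ℕ → Vec d} {t : ℕ}
    (hy : ∀ s < t, ‖y s‖ ≤ 1) :
    ∑ s ∈ Finset.range t, min 1 ((y s).ofLp ⬝ᵥ ((gram lam y s)⁻¹ *ᵥ (y s).ofLp))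
      ≤ 2 * (d * Real.log (1 + t / lam)) := by
  have h1 : ∀ w : ℝ, 0 ≤ w → min 1 w ≤ 2 * Real.log (1 + w) := by
    intro w hw
    have hlog : ∀ u : ℝ, 0 ≤ u → u ≤ 1 → u ≤ 2 * Real.log (1 + u) := by
      intro u hu hu1
      have h := Real.one_sub_inv_le_log_of_pos (show 0 < 1 + u by linarith)
      have : u / 2 ≤ 1 - (1 + u)⁻¹ := by
        rw [show 1 - (1 + u)⁻¹ = u / (1 + u) by field_simp; ring]
        exact div_le_div_of_nonneg_left hu (by linarith) (by linarith)
      linarith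
    rcases le_total w 1 with h | h
    · rw [min_eq_right h]; exact hlog w hw h
    · rw [min_eq_left h]
      refine (hlog 1 zero_le_one le_rfl).trans ?_
      have := Real.log_le_log (show (0 : ℝ) < 1 + 1 by norm_num)
        (show 1 + 1 ≤ 1 + w by linarith)
      linarith
  refine (Finset.sum_le_sum fun s _ =>
    h1 _ (dotProduct_mulVec_nonneg (posDef_gram hlam y s).inv _)).trans ?_
  rw [← Finset.mul_sum, sum_log_one_add_eq hlam]
  have h2 := Real.log_le_log (posDef_gram hlam y t).det_pos (det_gram_le hlam hy)
  have h3 : Real.log ((lam + t) ^ d) - Real.log (lam ^ d) = d * Real.log (1 + t / lam) := by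
    rw [Real.log_pow, Real.log_pow, ← mul_sub, ← Real.log_div (by positivity) hlam.ne']
    congr 2; field_simp
  linarith

variable {Ω : Type*} {m : MeasurableSpace Ω}

lemma measurable_matrix_inv_apply {A : Ω → Matrix (Fin d) (Fin d) ℝ}
    (hA : ∀ i j, Measurable fun ω => A ω i j) (i j : Fin d) :
    Measurable fun ω => (A ω)⁻¹ i j := by
  have hdet : ∀ {B : Ω → Matrix (Fin d) (Fin d) ℝ}, (∀ i j, Measurable fun ω => B ω i j) →
      Measurable fun ω => (B ω).det := by
    intro B hB
    simp only [Matrix.det_apply]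
    exact Finset.measurable_sum _ fun σ _ =>
      (Finset.measurable_fun_prod _ fun i _ => hB _ _).const_smul _
  simp only [Matrix.inv_def, Matrix.smul_apply, smul_eq_mul, Ring.inverse_eq_inv',
    Matrix.adjugate_apply]
  refine (hdet hA).inv.mul (hdet fun k l => ?_)
  simp only [Matrix.updateRow_apply]
  split_ifs
  exacts [measurable_const, hA k l]

lemma measurable_dotProduct_inv_mulVec {A : Ω → Matrix (Fin d) (Fin d) ℝ} {u v : Ω → Fin d → ℝ}
    (hA : ∀ i j, Measurable fun ω => A ω i j) (hu : ∀ i, Measurable fun ω => u ω i)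
    (hv : ∀ i, Measurable fun ω => v ω i) :
    Measurable fun ω => u ω ⬝ᵥ ((A ω)⁻¹ *ᵥ v ω) := by
  simp only [dotProduct, Matrix.mulVec]
  exact Finset.measurable_sum _ fun i _ => (hu i).mul
    (Finset.measurable_sum _ fun j _ => (measurable_matrix_inv_apply hA i j).mul (hv j))

lemma measurable_ofLp_apply {y : Ω → Vec d} (hy : Measurable y) (i : Fin d) :
    Measurable fun ω => (y ω).ofLp i :=
  (measurable_pi_apply i).comp ((WithLp.measurable_ofLp 2 _).comp hy)

lemma measurable_gram_apply {lam : ℝ} {y : ℕ → Ω → Vec d} {t : ℕ}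
    (hy : ∀ s < t, Measurable (y s)) (i j : Fin d) :
    Measurable fun ω => gram lam (fun s => y s ω) t i j := by
  simp only [gram, Matrix.add_apply, Matrix.sum_apply, Matrix.vecMulVec_apply]
  refine measurable_const.add (Finset.measurable_sum _ fun s hs => ?_)
  have := hy s (Finset.mem_range.1 hs)
  exact (measurable_ofLp_apply this i).mul (measurable_ofLp_apply this j)

lemma measurable_armSum_apply {y : ℕ → Ω → Vec d} {η : ℕ → Ω → ℝ} {t : ℕ}
    (hy : ∀ s < t, Measurable (y s)) (hη : ∀ s < t, Measurable (η s)) (i : Fin d) :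
    Measurable fun ω => armSum (fun s => y s ω) (fun s => η s ω) t i := by
  simp only [armSum, Finset.sum_apply, Pi.smul_apply, smul_eq_mul]
  exact Finset.measurable_sum _ fun s hs => (hη s (Finset.mem_range.1 hs)).mul
    (measurable_ofLp_apply (hy s (Finset.mem_range.1 hs)) i)

end

/-! ### The self-normalized supermartingale -/

/-- The factor by which `exp (‖S‖²) / √det V` changes when `x` with `x ⬝ V⁻¹ S = c` and
`x ⬝ V⁻¹ x = w` and the noise `η` are added. -/
noncomputable def stepFactor (c w η : ℝ) : ℝ :=
  Real.exp ((2 * η * c + η ^ 2 * w - c ^ 2) / (1 + w)) / Real.sqrt (1 + w)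

lemma stepFactor_nonneg (c w η : ℝ) : 0 ≤ stepFactor c w η := by
  unfold stepFactor; positivity

lemma measurable_stepFactor {Ω : Type*} {m : MeasurableSpace Ω} {c w η : Ω → ℝ}
    (hc : Measurable c) (hw : Measurable w) (hη : Measurable η) :
    Measurable fun ω => stepFactor (c ω) (w ω) (η ω) := by
  unfold stepFactor; fun_prop

/-- The factor is a Gaussian mixture of `exp (2 g η - g ^ 2)`. -/
lemma lintegral_gaussianReal_exp (c η : ℝ) {w : ℝ} (hw : 0 ≤ w) :
    ∫⁻ g, ENNReal.ofReal (Real.exp (2 * g * η - g ^ 2)) ∂(gaussianReal c (w / 2).toNNReal)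
      = ENNReal.ofReal (stepFactor c w η) := by
  rcases hw.eq_or_lt with rfl | hw
  -- For `w = 0` the mixing Gaussian has no density and is the Dirac mass at `c`.
  · rw [zero_div, Real.toNNReal_zero, gaussianReal_zero_var, lintegral_dirac]
    simp only [stepFactor, add_zero, Real.sqrt_one, div_one, mul_zero]
    congr 3; ring
  · have hv : (w / 2).toNNReal ≠ 0 := by simpa using by positivity
    have hv' : (w / (2 * (1 + w))).toNNReal ≠ 0 := by simpa using by positivity
    have hm : Measurable fun g : ℝ => ENNReal.ofReal (Real.exp (2 * g * η - g ^ 2)) := by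
      fun_prop
    rw [gaussianReal_of_var_ne_zero _ hv, lintegral_withDensity_eq_lintegral_mul _
      (measurable_gaussianPDF _ _) hm]
    -- Completing the square in `g` leaves a Gaussian density with mean `(c + η w) / (1 + w)` and
    -- variance `w / (2 (1 + w))`, times the factor.
    have key : ∀ g : ℝ, (gaussianPDF c (w / 2).toNNReal
          * fun g : ℝ => ENNReal.ofReal (Real.exp (2 * g * η - g ^ 2))) g
        = ENNReal.ofReal (stepFactor c w η)
          * gaussianPDF ((c + η * w) / (1 + w)) (w / (2 * (1 + w))).toNNReal g := by
      intro g
      simp only [Pi.mul_apply, gaussianPDF, gaussianPDFReal]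
      rw [← ENNReal.ofReal_mul (by positivity), ← ENNReal.ofReal_mul (stepFactor_nonneg _ _ _)]
      congr 1
      rw [Real.coe_toNNReal _ (by positivity), Real.coe_toNNReal _ (by positivity), stepFactor]
      have h1 : Real.sqrt (2 * Real.pi * (w / 2))
          = Real.sqrt (1 + w) * Real.sqrt (2 * Real.pi * (w / (2 * (1 + w)))) := by
        rw [← Real.sqrt_mul (by positivity)]
        congr 1; field_simp
      rw [h1, mul_inv, mul_assoc, ← Real.exp_add, div_eq_mul_inv (Real.exp _)]
      have h2 : -(g - c) ^ 2 / (2 * (w / 2)) + (2 * g * η - g ^ 2)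
          = (2 * η * c + η ^ 2 * w - c ^ 2) / (1 + w)
            + -(g - (c + η * w) / (1 + w)) ^ 2 / (2 * (w / (2 * (1 + w)))) := by
        field_simp
        ring
      rw [h2, Real.exp_add]
      ring
    simp only [key]
    rw [lintegral_const_mul _ (measurable_gaussianPDF _ _), lintegral_gaussianPDF_eq_one _ hv',
      mul_one]

/-- Method of mixtures: after exchanging the integrals, the hypothesis at `s = 2 g` gives `exp (g ^
2)`, which cancels `exp (-g ^ 2)` exactly. In the application `μ` is restricted to the good event
and `q` is its mass. -/
lemma lintegral_stepFactor_le {Z : Type*} [MeasurableSpace Z] {μ : Measure Z} [SFinite μ]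
    {f : Z → ℝ} (hf : Measurable f) {q : ENNReal}
    (hμ : ∀ s : ℝ, ∫⁻ z, ENNReal.ofReal (Real.exp (s * f z)) ∂μ
      ≤ ENNReal.ofReal (Real.exp (s ^ 2 / 4)) * q) (c : ℝ) {w : ℝ} (hw : 0 ≤ w) :
    ∫⁻ z, ENNReal.ofReal (stepFactor c w (f z)) ∂μ ≤ q := by
  simp only [← lintegral_gaussianReal_exp c _ hw]
  rw [lintegral_lintegral_swap (by fun_prop)]
  calc ∫⁻ g, ∫⁻ z, ENNReal.ofReal (Real.exp (2 * g * f z - g ^ 2)) ∂μ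
        ∂(gaussianReal c (w / 2).toNNReal)
      ≤ ∫⁻ _, q ∂(gaussianReal c (w / 2).toNNReal) := by
        refine lintegral_mono fun g => ?_
        have h1 : ∀ z, ENNReal.ofReal (Real.exp (2 * g * f z - g ^ 2))
            = ENNReal.ofReal (Real.exp (-g ^ 2)) * ENNReal.ofReal (Real.exp (2 * g * f z)) := by
          intro z
          rw [← ENNReal.ofReal_mul (Real.exp_pos _).le, ← Real.exp_add]
          congr 2; ring
        simp only [h1]
        rw [lintegral_const_mul _ (by fun_prop)]
        refine (mul_le_mul_right (hμ (2 * g)) _).trans ?_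
        rw [← mul_assoc, ← ENNReal.ofReal_mul (Real.exp_pos _).le, ← Real.exp_add]
        rw [show -g ^ 2 + (2 * g) ^ 2 / 4 = 0 by ring]
        simp
    _ = q := by simp

/-- Ville's maximal inequality for a supermartingale `Ψ` under a change of measure with
density process `N`. -/
lemma mul_setLIntegral_exists_le {Ω : Type*} {mΩ : MeasurableSpace Ω} {P : Measure Ω}
    [IsProbabilityMeasure P] (𝒢 : Filtration ℕ mΩ) {N Ψ : ℕ → Ω → ENNReal} (L : ENNReal)
    (hN : ∀ t, Measurable (N t)) (hΨ : ∀ t, Measurable[𝒢 t] (Ψ t))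
    (hN0 : N 0 = 1) (hΨ0 : Ψ 0 = 1)
    (hNs : ∀ t A, MeasurableSet[𝒢 t] A → ∫⁻ ω in A, N (t + 1) ω ∂P = ∫⁻ ω in A, N t ω ∂P)
    (hΨs : ∀ t A, MeasurableSet[𝒢 t] A →
      ∫⁻ ω in A, N (t + 1) ω * Ψ (t + 1) ω ∂P ≤ ∫⁻ ω in A, N t ω * Ψ t ω ∂P) (m : ℕ) :
    L * ∫⁻ ω in {ω | ∃ t ≤ m, L ≤ Ψ t ω}, N m ω ∂P ≤ 1 := by
  have hΨ' : ∀ t, Measurable (Ψ t) := fun t => (hΨ t).mono (𝒢.le t) le_rfl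
  have hbad : ∀ t, MeasurableSet[𝒢 t] {ω | ∃ s ≤ t, L ≤ Ψ s ω} := by
    intro t
    have : {ω | ∃ s ≤ t, L ≤ Ψ s ω} = ⋃ s ∈ Finset.range (t + 1), {ω | L ≤ Ψ s ω} := by
      ext ω; simp
    rw [this]
    refine Finset.measurableSet_biUnion _ fun s hs => ?_
    have hs' : s ≤ t := Nat.lt_succ_iff.1 (Finset.mem_range.1 hs)
    exact 𝒢.mono hs' _ (@measurableSet_le _ _ _ _ _ (𝒢 s) _ _ _ _ _ measurable_const (hΨ s))
  -- Invariant of the stopped process: `L` times the `N`-mass of the paths that have crossed, plus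
  -- the `N Ψ`-mass of the others. Paths crossing at time `t + 1` have `Ψ ≥ L`, so moving them to
  -- the first term does not increase the total.
  have key : ∀ t, L * ∫⁻ ω in {ω | ∃ s ≤ t, L ≤ Ψ s ω}, N t ω ∂P
      + ∫⁻ ω in {ω | ∃ s ≤ t, L ≤ Ψ s ω}ᶜ, N t ω * Ψ t ω ∂P ≤ 1 := by
    intro t
    induction t with
    | zero =>
      have hb := 𝒢.le 0 _ (hbad 0)
      have h1 : L * ∫⁻ ω in {ω | ∃ s ≤ 0, L ≤ Ψ s ω}, N 0 ω ∂P
          ≤ ∫⁻ ω in {ω | ∃ s ≤ 0, L ≤ Ψ s ω}, N 0 ω * Ψ 0 ω ∂P := by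
        rw [← lintegral_const_mul _ (hN 0)]
        refine setLIntegral_mono ((hN 0).mul (hΨ' 0)) fun ω hω => ?_
        obtain ⟨s, hs, h⟩ := hω
        obtain rfl : s = 0 := by omega
        rw [mul_comm]; exact mul_le_mul_right h _
      refine (add_le_add_left h1 _).trans ?_
      rw [lintegral_add_compl _ hb, hN0, hΨ0]
      simp
    | succ t ih =>
      have hb := 𝒢.le t _ (hbad t)
      have hb' := 𝒢.le _ _ (hbad (t + 1))
      set b := {ω | ∃ s ≤ t, L ≤ Ψ s ω}
      set b' := {ω | ∃ s ≤ t + 1, L ≤ Ψ s ω}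
      have hbb : b ⊆ b' := fun ω ⟨s, hs, h⟩ => ⟨s, by omega, h⟩
      have hnew : ∀ ω ∈ b' \ b, L ≤ Ψ (t + 1) ω := by
        rintro ω ⟨⟨s, hs, h⟩, hn⟩
        rcases Nat.le_succ_iff.1 hs with h' | h'
        · exact absurd ⟨s, h', h⟩ hn
        · rwa [h'] at h
      have hm : Measurable fun ω => N (t + 1) ω * Ψ (t + 1) ω := (hN _).mul (hΨ' _)
      have h1 : ∫⁻ ω in b', N (t + 1) ω ∂P
          = ∫⁻ ω in b, N (t + 1) ω ∂P + ∫⁻ ω in b' \ b, N (t + 1) ω ∂P := by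
        rw [← lintegral_inter_add_sdiff _ b' hb, Set.inter_eq_right.2 hbb]
      have h2 : L * ∫⁻ ω in b' \ b, N (t + 1) ω ∂P
          ≤ ∫⁻ ω in b' \ b, N (t + 1) ω * Ψ (t + 1) ω ∂P := by
        rw [← lintegral_const_mul _ (hN _)]
        refine setLIntegral_mono hm fun ω hω => ?_
        rw [mul_comm]; exact mul_le_mul_right (hnew ω hω) _
      have h3 : ∫⁻ ω in bᶜ, N (t + 1) ω * Ψ (t + 1) ω ∂P
          = ∫⁻ ω in b' \ b, N (t + 1) ω * Ψ (t + 1) ω ∂P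
            + ∫⁻ ω in b'ᶜ, N (t + 1) ω * Ψ (t + 1) ω ∂P := by
        rw [← lintegral_inter_add_sdiff _ bᶜ hb']
        congr 3
        · ext ω; simp [and_comm]
        · ext ω
          simp only [Set.mem_sdiff, Set.mem_compl_iff]
          exact ⟨fun h => h.2, fun h => ⟨fun h' => h (hbb h'), h⟩⟩
      calc L * ∫⁻ ω in b', N (t + 1) ω ∂P + ∫⁻ ω in b'ᶜ, N (t + 1) ω * Ψ (t + 1) ω ∂P
          = L * ∫⁻ ω in b, N (t + 1) ω ∂P + (L * ∫⁻ ω in b' \ b, N (t + 1) ω ∂P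
            + ∫⁻ ω in b'ᶜ, N (t + 1) ω * Ψ (t + 1) ω ∂P) := by rw [h1, mul_add, add_assoc]
        _ ≤ L * ∫⁻ ω in b, N (t + 1) ω ∂P + ∫⁻ ω in bᶜ, N (t + 1) ω * Ψ (t + 1) ω ∂P := by
            rw [h3]; gcongr
        _ ≤ L * ∫⁻ ω in b, N t ω ∂P + ∫⁻ ω in bᶜ, N t ω * Ψ t ω ∂P := by
            rw [hNs t b (hbad t)]
            gcongr 1
            exact hΨs t bᶜ (hbad t).compl
        _ ≤ 1 := ih
  exact le_self_add.trans (key m)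

section

variable {d : ℕ}

/-- `x_t ⬝ V_t⁻¹ x_t`. -/
noncomputable def armWeight (lam : ℝ) (y : ℕ → Vec d) (t : ℕ) : ℝ :=
  (y t).ofLp ⬝ᵥ ((gram lam y t)⁻¹ *ᵥ (y t).ofLp)

/-- `x_t ⬝ V_t⁻¹ S_t`. -/
noncomputable def armCross (lam : ℝ) (y : ℕ → Vec d) (η : ℕ → ℝ) (t : ℕ) : ℝ :=
  (y t).ofLp ⬝ᵥ ((gram lam y t)⁻¹ *ᵥ armSum y η t)

/-- The normalized process `√(det V_0 / det V_t) exp (S_t ⬝ V_t⁻¹ S_t)`. -/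
noncomputable def expProcess (lam : ℝ) (y : ℕ → Vec d) (η : ℕ → ℝ) (t : ℕ) : ℝ :=
  ∏ s ∈ Finset.range t, stepFactor (armCross lam y η s) (armWeight lam y s) (η s)

lemma expProcess_nonneg (lam : ℝ) (y : ℕ → Vec d) (η : ℕ → ℝ) (t : ℕ) :
    0 ≤ expProcess lam y η t :=
  Finset.prod_nonneg fun _ _ => stepFactor_nonneg _ _ _

lemma expProcess_succ (lam : ℝ) (y : ℕ → Vec d) (η : ℕ → ℝ) (t : ℕ) :
    expProcess lam y η (t + 1) = expProcess lam y η t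
      * stepFactor (armCross lam y η t) (armWeight lam y t) (η t) :=
  Finset.prod_range_succ _ _

/-- The product form suits the one-step supermartingale argument, the closed form suits the
confidence set. The rank-one update of the quadratic form and the determinant lemma link them. -/
lemma expProcess_eq {lam : ℝ} (hlam : 0 < lam) (y : ℕ → Vec d) (η : ℕ → ℝ) (t : ℕ) :
    expProcess lam y η t = Real.exp (armSum y η t ⬝ᵥ ((gram lam y t)⁻¹ *ᵥ armSum y η t))
      * (Real.sqrt (lam ^ d) / Real.sqrt (gram lam y t).det) := by
  induction t with
  | zero =>
    have : Real.sqrt (lam ^ d) ≠ 0 := (Real.sqrt_pos.2 (by positivity)).ne'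
    simp [expProcess, gram_zero, armSum, this]
  | succ t ih =>
    have hV := posDef_gram hlam y t
    rw [expProcess_succ, ih, gram_succ, armSum_succ,
      dotProduct_inv_add_vecMulVec hV, det_add_vecMulVec hV, stepFactor, Real.exp_add,
      Real.sqrt_mul hV.det_pos.le]
    simp only [armCross, armWeight]
    rw [div_mul_eq_div_div]
    ring

lemma armWeight_nonneg {lam : ℝ} (hlam : 0 < lam) (y : ℕ → Vec d) (t : ℕ) :
    0 ≤ armWeight lam y t :=
  dotProduct_mulVec_nonneg (posDef_gram hlam y t).inv _

variable {Ω : Type*} {m : MeasurableSpace Ω}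

lemma measurable_armWeight {lam : ℝ} {y : ℕ → Ω → Vec d} {t : ℕ}
    (hy : ∀ s ≤ t, Measurable (y s)) : Measurable fun ω => armWeight lam (fun s => y s ω) t :=
  measurable_dotProduct_inv_mulVec (measurable_gram_apply fun s hs => hy s hs.le)
    (measurable_ofLp_apply (hy t le_rfl)) (measurable_ofLp_apply (hy t le_rfl))

lemma measurable_armCross {lam : ℝ} {y : ℕ → Ω → Vec d} {η : ℕ → Ω → ℝ} {t : ℕ}
    (hy : ∀ s ≤ t, Measurable (y s)) (hη : ∀ s < t, Measurable (η s)) :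
    Measurable fun ω => armCross lam (fun s => y s ω) (fun s => η s ω) t :=
  measurable_dotProduct_inv_mulVec (measurable_gram_apply fun s hs => hy s hs.le)
    (measurable_ofLp_apply (hy t le_rfl))
    (measurable_armSum_apply (fun s hs => hy s hs.le) hη)

lemma measurable_expProcess {lam : ℝ} {y : ℕ → Ω → Vec d} {η : ℕ → Ω → ℝ} {t : ℕ}
    (hy : ∀ s < t, Measurable (y s)) (hη : ∀ s < t, Measurable (η s)) :
    Measurable fun ω => expProcess lam (fun s => y s ω) (fun s => η s ω) t := by
  refine Finset.measurable_fun_prod _ fun s hs => ?_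
  have hs := Finset.mem_range.1 hs
  exact measurable_stepFactor
    (measurable_armCross (fun u hu => hy u (by omega)) fun u hu => hη u (by omega))
    (measurable_armWeight fun u hu => hy u (by omega)) (hη s hs)

end

/-- The information available before each round of `n` pulls. -/
def roundFiltration {Ω : Type*} {mΩ : MeasurableSpace Ω} (ℱ : Filtration ℕ mΩ) (n : ℕ) :
    Filtration ℕ mΩ where
  seq t := ℱ (t * n)
  mono' _ _ h := ℱ.mono (Nat.mul_le_mul_right n h)
  le' t := ℱ.le (t * n)

section

variable {d : ℕ} {Ω : Type*} [mΩ : MeasurableSpace Ω] {P : Measure Ω} [IsProbabilityMeasure P]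
  {ℱ : Filtration ℕ mΩ} {θ : Vec d} {ν : Kernel (Vec d) ℝ} [IsMarkovKernel ν]
  {a : ℕ → Ω → Vec d} {r : ℕ → Ω → ℝ}

/-- If on the event `G` the round noise `M` is sub-Gaussian with variance proxy `1 / 2`, and `G`
has probability at least `p` in each round, then with probability at least `p ^ m * (1 - 1 / L)`
the self-normalized process stays below `L` for `m` rounds. -/
theorem IsInteraction.le_measure_expProcess_lt (h : IsInteraction P ℱ θ ν a r) {n : ℕ}
    (ha : ∀ᵐ ω ∂P, ∀ t, ∀ j < n, a (t * n + j) ω = a (t * n) ω)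
    {X : Set (Vec d)} (hX : ∀ᵐ ω ∂P, ∀ t, a (t * n) ω ∈ X)
    {G : Set (Fin n → ℝ)} (hG : MeasurableSet G) {M : (Fin n → ℝ) → ℝ} (hM : Measurable M)
    {p : ENNReal} (hp0 : p ≠ 0) (hp : ∀ x ∈ X, p ≤ roundKernel ν n x G)
    (hsub : ∀ x ∈ X, ∀ s : ℝ, ∫⁻ z in G, ENNReal.ofReal (Real.exp (s * M z)) ∂(roundKernel ν n x)
      ≤ ENNReal.ofReal (Real.exp (s ^ 2 / 4)) * roundKernel ν n x G)
    {lam : ℝ} (hlam : 0 < lam) (L : ENNReal) (m : ℕ) :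
    p ^ m * (1 - L⁻¹) ≤ P {ω | ∀ t ≤ m, ENNReal.ofReal (expProcess lam (fun t => a (t * n) ω)
      (fun t => M (noiseVector θ a r n (t * n) ω)) t) < L} := by
  set 𝒢 := roundFiltration ℱ n
  set y : ℕ → Ω → Vec d := fun t ω => a (t * n) ω
  set z : ℕ → Ω → Fin n → ℝ := fun t ω => noiseVector θ a r n (t * n) ω
  set η : ℕ → Ω → ℝ := fun t ω => M (z t ω)
  let q : Vec d → ENNReal := fun x => roundKernel ν n x G
  let Ψ : ℕ → Ω → ENNReal := fun t ω =>
    ENNReal.ofReal (expProcess lam (fun s => y s ω) (fun s => η s ω) t)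
  -- Density of the law in which each round is conditioned on `G`, given the arm of that round.
  let N : ℕ → Ω → ENNReal := fun t ω =>
    ∏ s ∈ Finset.range t, (G.indicator 1 (z s ω) * (q (y s ω))⁻¹)
  have hqm : Measurable q := (roundKernel ν n).measurable_coe hG
  have hy : ∀ s t, s ≤ t → Measurable[𝒢 t] (y s) := fun s t hst =>
    (h.measurable_arm (s * n)).mono (𝒢.mono hst) le_rfl
  have hz : ∀ s t, s < t → Measurable[𝒢 t] (z s) := fun s t hst =>
    (h.measurable_noiseVector n (s * n)).mono
      (ℱ.mono (by rw [← Nat.succ_mul]; exact Nat.mul_le_mul_right n hst)) le_rfl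
  have hη : ∀ s t, s < t → Measurable[𝒢 t] (η s) := fun s t hst => hM.comp (hz s t hst)
  have hΨm : ∀ t, Measurable[𝒢 t] (Ψ t) := fun t =>
    (measurable_expProcess (m := 𝒢 t) (fun s hs => hy s t hs.le)
      fun s hs => hη s t hs).ennreal_ofReal
  have hNm : ∀ t, Measurable[𝒢 t] (N t) := fun t =>
    Finset.measurable_fun_prod _ fun s hs => by
      have hs := Finset.mem_range.1 hs
      exact ((measurable_one.indicator hG).comp (hz s t hs)).mul
        (hqm.comp (hy s t hs.le)).inv
  have hNm' : ∀ t, Measurable (N t) := fun t => (hNm t).mono (𝒢.le t) le_rfl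
  have hN_succ : ∀ t ω, N (t + 1) ω = N t ω * (G.indicator 1 (z t ω) * (q (y t ω))⁻¹) :=
    fun t ω => Finset.prod_range_succ _ _
  have hΨ_succ : ∀ t ω, Ψ (t + 1) ω = Ψ t ω * ENNReal.ofReal (stepFactor
      (armCross lam (fun s => y s ω) (fun s => η s ω) t) (armWeight lam (fun s => y s ω) t)
      (η t ω)) := by
    intro t ω
    simp only [Ψ]
    rw [← ENNReal.ofReal_mul (expProcess_nonneg _ _ _ _), expProcess_succ]
  have hat : ∀ t, ∀ᵐ ω ∂P, ∀ j < n, a (t * n + j) ω = a (t * n) ω := fun t =>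
    ha.mono fun ω hω => hω t
  have hNs : ∀ t A, MeasurableSet[𝒢 t] A →
      ∫⁻ ω in A, N (t + 1) ω ∂P = ∫⁻ ω in A, N t ω ∂P := by
    intro t A hA
    have hA' := 𝒢.le t A hA
    rw [← lintegral_indicator hA', ← lintegral_indicator hA']
    have hpm : Measurable[𝒢 t] fun ω => A.indicator (N t) ω * (q (y t ω))⁻¹ :=
      ((hNm t).indicator hA).mul (hqm.comp (hy t t le_rfl)).inv
    have hF : Measurable fun e : ENNReal × (Fin n → ℝ) => e.1 * G.indicator 1 e.2 :=
      measurable_fst.mul ((measurable_one.indicator hG).comp measurable_snd)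
    calc ∫⁻ ω, A.indicator (N (t + 1)) ω ∂P
        = ∫⁻ ω, (A.indicator (N t) ω * (q (y t ω))⁻¹) * G.indicator 1 (z t ω) ∂P := by
          refine lintegral_congr fun ω => ?_
          by_cases hω : ω ∈ A
          · rw [Set.indicator_of_mem hω, Set.indicator_of_mem hω, hN_succ]; ring
          · rw [Set.indicator_of_notMem hω, Set.indicator_of_notMem hω, zero_mul, zero_mul]
      _ = ∫⁻ ω, ∫⁻ z, (A.indicator (N t) ω * (q (y t ω))⁻¹) * G.indicator 1 z
            ∂(roundKernel ν n (y t ω)) ∂P :=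
          h.lintegral_noiseVector (t * n) n (hat t) hpm hF
      _ = ∫⁻ ω, A.indicator (N t) ω ∂P := by
          refine lintegral_congr_ae (hX.mono fun ω hω => ?_)
          dsimp only
          rw [lintegral_const_mul _ (measurable_one.indicator hG), lintegral_indicator_one hG,
            mul_assoc, ENNReal.inv_mul_cancel, mul_one]
          · exact ((pos_iff_ne_zero.2 hp0).trans_le (hp _ (hω t))).ne'
          · exact measure_ne_top _ _
  have hΨs : ∀ t A, MeasurableSet[𝒢 t] A →
      ∫⁻ ω in A, N (t + 1) ω * Ψ (t + 1) ω ∂P ≤ ∫⁻ ω in A, N t ω * Ψ t ω ∂P := by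
    intro t A hA
    have hA' := 𝒢.le t A hA
    rw [← lintegral_indicator hA', ← lintegral_indicator hA']
    let cr : Ω → ℝ := fun ω => armCross lam (fun s => y s ω) (fun s => η s ω) t
    let wt : Ω → ℝ := fun ω => armWeight lam (fun s => y s ω) t
    -- Everything known before the round is packed into one variable, so that the noise can be
    -- integrated against `roundKernel` with the past frozen.
    have hpm : Measurable[𝒢 t] fun ω =>
        (A.indicator (fun ω => N t ω * Ψ t ω) ω * (q (y t ω))⁻¹, cr ω, wt ω) :=
      ((((hNm t).mul (hΨm t)).indicator hA).mul (hqm.comp (hy t t le_rfl)).inv).prodMk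
        ((measurable_armCross (m := 𝒢 t) (fun s hs => hy s t hs) fun s hs => hη s t hs).prodMk
          (measurable_armWeight (m := 𝒢 t) fun s hs => hy s t hs))
    have hF : Measurable fun e : (ENNReal × ℝ × ℝ) × (Fin n → ℝ) =>
        e.1.1 * G.indicator (fun z => ENNReal.ofReal (stepFactor e.1.2.1 e.1.2.2 (M z))) e.2 := by
      have h1 : Measurable fun e : (ENNReal × ℝ × ℝ) × (Fin n → ℝ) =>
          (Prod.snd ⁻¹' G).indicator
            (fun e => ENNReal.ofReal (stepFactor e.1.2.1 e.1.2.2 (M e.2))) e :=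
        (measurable_stepFactor (by fun_prop) (by fun_prop)
          (hM.comp measurable_snd)).ennreal_ofReal.indicator (measurable_snd hG)
      exact measurable_fst.fst.mul h1
    calc ∫⁻ ω, A.indicator (fun ω => N (t + 1) ω * Ψ (t + 1) ω) ω ∂P
        = ∫⁻ ω, (A.indicator (fun ω => N t ω * Ψ t ω) ω * (q (y t ω))⁻¹)
            * G.indicator (fun z => ENNReal.ofReal (stepFactor (cr ω) (wt ω) (M z)))
              (z t ω) ∂P := by
          refine lintegral_congr fun ω => ?_
          by_cases hω : ω ∈ A
          · rw [Set.indicator_of_mem hω, Set.indicator_of_mem hω, hN_succ, hΨ_succ]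
            by_cases hg : z t ω ∈ G
            · rw [Set.indicator_of_mem hg, Set.indicator_of_mem hg, Pi.one_apply]; ring
            · rw [Set.indicator_of_notMem hg, Set.indicator_of_notMem hg]; ring
          · rw [Set.indicator_of_notMem hω, Set.indicator_of_notMem hω, zero_mul, zero_mul]
      _ = ∫⁻ ω, ∫⁻ z, (A.indicator (fun ω => N t ω * Ψ t ω) ω * (q (y t ω))⁻¹)
            * G.indicator (fun z => ENNReal.ofReal (stepFactor (cr ω) (wt ω) (M z))) z
            ∂(roundKernel ν n (y t ω)) ∂P :=
          h.lintegral_noiseVector (t * n) n (hat t) hpm hF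
      _ ≤ ∫⁻ ω, A.indicator (fun ω => N t ω * Ψ t ω) ω ∂P := by
          refine lintegral_mono_ae (hX.mono fun ω hω => ?_)
          have hm : Measurable fun z => ENNReal.ofReal (stepFactor (cr ω) (wt ω) (M z)) :=
            (measurable_stepFactor measurable_const measurable_const hM).ennreal_ofReal
          rw [lintegral_const_mul _ (hm.indicator hG), lintegral_indicator hG, mul_assoc]
          have h1 := lintegral_stepFactor_le (μ := (roundKernel ν n (y t ω)).restrict G) hM
            (hsub _ (hω t)) (cr ω) (armWeight_nonneg hlam (fun s => y s ω) t)
          have h2 : (q (y t ω))⁻¹ * ∫⁻ z in G, ENNReal.ofReal (stepFactor (cr ω) (wt ω) (M z))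
              ∂(roundKernel ν n (y t ω)) ≤ 1 :=
            (mul_le_mul_right h1 _).trans (ENNReal.inv_mul_le_one _)
          exact (mul_le_mul_right h2 _).trans (mul_one _).le
  have hN0 : N 0 = 1 := by ext ω; simp [N]
  have hΨ0 : Ψ 0 = 1 := by ext ω; simp [Ψ, expProcess]
  have hville := mul_setLIntegral_exists_le 𝒢 L hNm' hΨm hN0 hΨ0 hNs hΨs m
  have htotal : ∀ t, ∫⁻ ω, N t ω ∂P = 1 := by
    intro t
    induction t with
    | zero => simp [hN0]
    | succ t ih =>
      have := hNs t Set.univ MeasurableSet.univ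
      rw [Measure.restrict_univ] at this
      rw [this, ih]
  set bad := {ω | ∃ t ≤ m, L ≤ Ψ t ω} with hbad
  have hbadm : MeasurableSet bad := by
    have : bad = ⋃ s ∈ Finset.range (m + 1), {ω | L ≤ Ψ s ω} := by
      ext ω; simp [hbad]
    rw [this]
    exact Finset.measurableSet_biUnion _ fun s _ =>
      measurableSet_le measurable_const ((hΨm s).mono (𝒢.le s) le_rfl)
  have hgood : {ω | ∀ t ≤ m, Ψ t ω < L} = badᶜ := by ext ω; simp [hbad]
  have hbadN : ∫⁻ ω in bad, N m ω ∂P ≤ L⁻¹ :=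
    ENNReal.le_inv_iff_mul_le.2 (by rwa [mul_comm] at hville)
  have hgoodN : 1 - L⁻¹ ≤ ∫⁻ ω in badᶜ, N m ω ∂P := by
    have := lintegral_add_compl (μ := P) (N m) hbadm
    rw [htotal] at this
    rw [tsub_le_iff_left, ← this]
    gcongr
  -- Each factor of the density is at most `p⁻¹`; this transfers the estimate back to `P`.
  have hNle : ∀ᵐ ω ∂P, p ^ m * N m ω ≤ 1 := by
    refine hX.mono fun ω hω => ?_
    simp only [N]
    rw [← Finset.card_range m, ← Finset.prod_const, Finset.card_range, ← Finset.prod_mul_distrib]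
    refine Finset.prod_le_one' fun s _ => ?_
    have h1 : G.indicator (1 : (Fin n → ℝ) → ENNReal) (z s ω) ≤ 1 :=
      Set.indicator_le_self' (fun _ _ => zero_le) _
    calc p * (G.indicator 1 (z s ω) * (q (y s ω))⁻¹)
        ≤ q (y s ω) * (1 * (q (y s ω))⁻¹) := by gcongr; exact hp _ (hω s)
      _ ≤ 1 := by rw [one_mul]; exact ENNReal.mul_inv_le_one _
  change _ ≤ P {ω | ∀ t ≤ m, Ψ t ω < L}
  rw [hgood]
  calc p ^ m * (1 - L⁻¹) ≤ p ^ m * ∫⁻ ω in badᶜ, N m ω ∂P := mul_le_mul_right hgoodN _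
    _ = ∫⁻ ω in badᶜ, p ^ m * N m ω ∂P := (lintegral_const_mul _ (hNm' m)).symm
    _ ≤ ∫⁻ _ in badᶜ, 1 ∂P := lintegral_mono_ae (ae_restrict_of_ae hNle)
    _ = P badᶜ := by simp

end

/-! ### Deterministic analysis of OFUL -/

section

variable {d : ℕ} {lam : ℝ} {y : ℕ → Vec d}

/-- The weighted reward sum is `V θ + S - lam θ`, so the error splits into a noise term and the bias
of the regularization. -/
lemma ridgeEstimate_sub (hlam : 0 < lam) (θ : Vec d) (η : ℕ → ℝ) (t : ℕ) :
    ridgeEstimate lam (fun s : Fin t => (y s, ⟪θ, y s⟫_ℝ + η s)) - θ.ofLp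
      = (gram lam y t)⁻¹ *ᵥ armSum y η t - (gram lam y t)⁻¹ *ᵥ (lam • θ.ofLp) := by
  have hV := posDef_gram hlam y t
  have h1 : ∑ s : Fin t, (⟪θ, y s⟫_ℝ + η s) • (y s).ofLp
      = gram lam y t *ᵥ θ.ofLp + (armSum y η t - lam • θ.ofLp) := by
    rw [Fin.sum_univ_eq_sum_range (fun s => (⟪θ, y s⟫_ℝ + η s) • (y s).ofLp), gram_mulVec]
    simp only [add_smul, Finset.sum_add_distrib, armSum, inner_eq_dotProduct,
      dotProduct_comm θ.ofLp]
    abel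
  rw [ridgeEstimate, designMatrix_eq_gram lam y (fun s => ⟪θ, y s⟫_ℝ + η s)]
  dsimp only
  rw [h1, Matrix.mulVec_add, inv_mulVec_mulVec hV, Matrix.mulVec_sub]
  abel

lemma det_smul_one (lam : ℝ) : (lam • (1 : Matrix (Fin d) (Fin d) ℝ)).det = lam ^ d := by
  simp

lemma pow_le_det_gram (hlam : 0 < lam) (t : ℕ) : lam ^ d ≤ (gram lam y t).det := by
  rw [← Real.log_le_log_iff (by positivity) (posDef_gram hlam y t).det_pos, ← sub_nonneg,
    ← sum_log_one_add_eq hlam]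
  exact Finset.sum_nonneg fun s _ => Real.log_nonneg (by
    have := dotProduct_mulVec_nonneg (posDef_gram hlam y s).inv (y s).ofLp; linarith)

lemma weightedNorm_inv_mulVec {V : Matrix (Fin d) (Fin d) ℝ} (hV : V.PosDef) (u : Fin d → ℝ) :
    weightedNorm V (V⁻¹ *ᵥ u) = Real.sqrt (u ⬝ᵥ (V⁻¹ *ᵥ u)) := by
  rw [weightedNorm, mulVec_inv_mulVec hV, dotProduct_comm]

/-- The true parameter is in the confidence set as long as the self-normalized process is
below `1 / δ ^ 2`. -/
lemma mem_confidenceSet (hlam : 0 < lam) {θ : Vec d} (hθ : ‖θ‖ ≤ 1) {δ : ℝ} (hδ : 0 < δ)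
    (η : ℕ → ℝ) {t : ℕ} (h : expProcess lam y η t < (δ ^ 2)⁻¹) :
    θ ∈ confidenceSet 1 1 lam δ (fun s : Fin t => (y s, ⟪θ, y s⟫_ℝ + η s)) := by
  have hV := posDef_gram hlam y t
  rw [confidenceSet, Set.mem_ofPred_eq, ridgeEstimate_sub hlam,
    designMatrix_eq_gram lam y (fun s => ⟪θ, y s⟫_ℝ + η s), det_smul_one, one_mul, mul_one]
  refine (weightedNorm_sub_le hV _ _).trans ?_
  rw [weightedNorm_inv_mulVec hV, weightedNorm_inv_mulVec hV]
  have hl : 0 < Real.sqrt (lam ^ d) := Real.sqrt_pos.2 (by positivity)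
  have hd : 0 < Real.sqrt (gram lam y t).det := Real.sqrt_pos.2 hV.det_pos
  refine add_le_add (Real.sqrt_le_sqrt ?_) (Real.sqrt_le_sqrt ?_)
  · rw [expProcess_eq hlam] at h
    set Q := armSum y η t ⬝ᵥ ((gram lam y t)⁻¹ *ᵥ armSum y η t)
    have h1 := Real.log_lt_log (by positivity) h
    rw [Real.log_mul (Real.exp_pos _).ne' (by positivity), Real.log_exp,
      Real.log_div hl.ne' hd.ne', Real.log_inv, Real.log_pow] at h1
    -- The process bound costs one logarithm of the ratio of root determinants while the squared
    -- radius has two; the ratio is at least `1`.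
    have h2 : Real.log (Real.sqrt (lam ^ d)) ≤ Real.log (Real.sqrt (gram lam y t).det) :=
      Real.log_le_log hl (Real.sqrt_le_sqrt (pow_le_det_gram hlam t))
    rw [Real.log_div (by positivity) hδ.ne', Real.log_div hd.ne' hl.ne']
    push_cast at h1
    linarith
  · rw [Matrix.mulVec_smul, dotProduct_smul, smul_dotProduct, smul_eq_mul, smul_eq_mul]
    have h1 := dotProduct_gram_inv_le hlam y t θ.ofLp
    rw [dotProduct_ofLp_self] at h1
    have h2 : ‖θ‖ ^ 2 ≤ 1 := pow_le_one₀ (norm_nonneg _) hθ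
    nlinarith

/-- Over `m` rounds the regret of OFUL is at most of order `d √m`, up to logarithms, if the true
parameter is in all the confidence sets. -/
theorem sum_regret_le (hlam : 0 < lam) (hd : 0 < d) {X : Set (Vec d)} {θ xstar : Vec d}
    {ρ : ℕ → ℝ} {δ ℓ c : ℝ} {m : ℕ} (hθ : ‖θ‖ ≤ 1) (hX : ∀ x ∈ X, ‖x‖ ≤ 1) (hxstar : xstar ∈ X)
    (hδ : 0 < δ) (hc : 0 ≤ c) (hℓ : 1 ≤ ℓ) (hδℓ : -Real.log δ ≤ ℓ)
    (hmℓ : Real.log (1 + m / lam) ≤ c * ℓ)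
    (hchoice : ∀ t < m, y t ∈ OFUL X 1 1 lam δ t (fun s : Fin t => (y s, ρ s)))
    (hconf : ∀ t < m, θ ∈ confidenceSet 1 1 lam δ (fun s : Fin t => (y s, ρ s))) :
    ∑ t ∈ Finset.range m, (⟪θ, xstar⟫_ℝ - ⟪θ, y t⟫_ℝ)
      ≤ 2 * (Real.sqrt (c + 2) + Real.sqrt lam + 1) * Real.sqrt (2 * c) * (d * ℓ)
        * Real.sqrt m := by
  have hy : ∀ t < m, ‖y t‖ ≤ 1 := fun t ht => hX _ (hchoice t ht).1
  have hd1 : (1 : ℝ) ≤ d := by exact_mod_cast hd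
  have hdℓ : 1 ≤ d * ℓ := one_le_mul_of_one_le_of_one_le hd1 hℓ
  have hdℓs : 1 ≤ Real.sqrt (d * ℓ) := Real.one_le_sqrt.2 hdℓ
  set β : ℝ := Real.sqrt (d * ℓ) * (Real.sqrt (c + 2) + Real.sqrt lam + 1) with hβ
  have hβ1 : 1 ≤ β := by
    refine hdℓs.trans (le_mul_of_one_le_right (by positivity) ?_)
    have := Real.sqrt_nonneg (c + 2); have := Real.sqrt_nonneg lam; linarith
  have hradius : ∀ t < m, Real.sqrt (2 * Real.log (Real.sqrt (gram lam y t).det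
      / Real.sqrt (lam ^ d) / δ)) + Real.sqrt lam ≤ β := by
    intro t ht
    have hV := posDef_gram hlam y t
    have hl : 0 < Real.sqrt (lam ^ d) := Real.sqrt_pos.2 (by positivity)
    have hdet : 0 < Real.sqrt (gram lam y t).det := Real.sqrt_pos.2 hV.det_pos
    have h1 : Real.log (gram lam y t).det - Real.log (lam ^ d) ≤ d * (c * ℓ) := by
      have h2 := Real.log_le_log hV.det_pos
        ((det_gram_le hlam fun s hs => hy s (hs.trans ht)).trans
          (pow_le_pow_left₀ (by positivity)
            (show lam + t ≤ lam + m by gcongr) d))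
      have h3 : Real.log ((lam + m) ^ d) - Real.log (lam ^ d) = d * Real.log (1 + m / lam) := by
        rw [Real.log_pow, Real.log_pow, ← mul_sub, ← Real.log_div (by positivity) hlam.ne']
        congr 2; field_simp
      have h4 := mul_le_mul_of_nonneg_left hmℓ (Nat.cast_nonneg (α := ℝ) d)
      linarith
    have h2 : 2 * Real.log (Real.sqrt (gram lam y t).det / Real.sqrt (lam ^ d) / δ)
        ≤ d * ℓ * (c + 2) := by
      rw [Real.log_div (by positivity) hδ.ne', Real.log_div hdet.ne' hl.ne',
        Real.log_sqrt hV.det_pos.le, Real.log_sqrt (by positivity)]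
      nlinarith
    have h3 := Real.sqrt_le_sqrt h2
    rw [Real.sqrt_mul (x := d * ℓ) (by positivity)] at h3
    rw [hβ]
    have h4 : Real.sqrt lam ≤ Real.sqrt (d * ℓ) * Real.sqrt lam :=
      le_mul_of_one_le_left (Real.sqrt_nonneg _) hdℓs
    have h5 := Real.sqrt_nonneg (d * ℓ)
    linarith
  have hround : ∀ t < m, ⟪θ, xstar⟫_ℝ - ⟪θ, y t⟫_ℝ
      ≤ 2 * β * Real.sqrt (min 1 (armWeight lam y t)) := by
    intro t ht
    have hV := posDef_gram hlam y t
    obtain ⟨-, ϑ, hϑ, hmax⟩ := hchoice t ht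
    -- Optimism: the pair `(xstar, θ)` competes in the maximization, so the chosen value is at least
    -- the optimal one.
    have h1 := hmax xstar hxstar θ (hconf t ht)
    have hmem : ∀ u : Vec d, u ∈ confidenceSet 1 1 lam δ (fun s : Fin t => (y s, ρ s)) →
        weightedNorm (gram lam y t)
          (ridgeEstimate lam (fun s : Fin t => (y s, ρ s)) - u.ofLp) ≤ β := by
      intro u hu
      rw [confidenceSet, Set.mem_ofPred_eq, designMatrix_eq_gram, det_smul_one, one_mul,
        mul_one] at hu
      exact hu.trans (hradius t ht)
    have h2 := weightedNorm_sub_le hV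
      (ridgeEstimate lam (fun s : Fin t => (y s, ρ s)) - θ.ofLp)
      (ridgeEstimate lam (fun s : Fin t => (y s, ρ s)) - ϑ.ofLp)
    rw [sub_sub_sub_cancel_left] at h2
    have h3 : weightedNorm (gram lam y t) (ϑ.ofLp - θ.ofLp) ≤ 2 * β := by
      have := hmem θ (hconf t ht); have := hmem ϑ hϑ; linarith
    have h4 : ⟪θ, xstar⟫_ℝ - ⟪θ, y t⟫_ℝ ≤ (y t).ofLp ⬝ᵥ (ϑ.ofLp - θ.ofLp) := by
      rw [real_inner_comm] at h1
      simp only [inner_eq_dotProduct] at h1 ⊢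
      rw [dotProduct_sub, dotProduct_comm (y t).ofLp θ.ofLp]
      linarith
    have h5 : (y t).ofLp ⬝ᵥ (ϑ.ofLp - θ.ofLp) ≤ Real.sqrt (armWeight lam y t) * (2 * β) := by
      refine (Real.le_sqrt_of_sq_le (dotProduct_sq_le hV _ _)).trans ?_
      rw [← armWeight, Real.sqrt_mul (armWeight_nonneg hlam y t)]
      exact mul_le_mul_of_nonneg_left h3 (Real.sqrt_nonneg _)
    -- The trivial bound covers weights above `1`, where `2 ≤ 2 * β`; this yields the `min` required
    -- by the elliptical potential lemma.
    have h6 : ⟪θ, xstar⟫_ℝ - ⟪θ, y t⟫_ℝ ≤ 2 := by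
      have h7 := abs_le.1 (abs_real_inner_le_norm θ xstar)
      have h8 := abs_le.1 (abs_real_inner_le_norm θ (y t))
      have h9 : ‖θ‖ * ‖xstar‖ ≤ 1 := mul_le_one₀ hθ (norm_nonneg _) (hX _ hxstar)
      have h10 : ‖θ‖ * ‖y t‖ ≤ 1 := mul_le_one₀ hθ (norm_nonneg _) (hy t ht)
      linarith [h7.2, h8.1]
    rcases le_total 1 (armWeight lam y t) with h | h
    · rw [min_eq_left h, Real.sqrt_one]; linarith
    · rw [min_eq_right h]; linarith
  have hmin : ∀ t, 0 ≤ min 1 (armWeight lam y t) := fun t =>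
    le_min zero_le_one (armWeight_nonneg hlam y t)
  have hsum : ∑ t ∈ Finset.range m, Real.sqrt (min 1 (armWeight lam y t))
      ≤ Real.sqrt m * (Real.sqrt (2 * c) * Real.sqrt (d * ℓ)) := by
    have h1 := sq_sum_le_card_mul_sum_sq (s := Finset.range m)
      (f := fun t => Real.sqrt (min 1 (armWeight lam y t)))
    simp only [Real.sq_sqrt (hmin _), Finset.card_range] at h1
    have h2 : ∑ t ∈ Finset.range m, min 1 (armWeight lam y t) ≤ 2 * c * (d * ℓ) := by
      refine (sum_min_one_le hlam hy).trans ?_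
      have := mul_le_mul_of_nonneg_left hmℓ (Nat.cast_nonneg (α := ℝ) d)
      linarith
    rw [← Real.sqrt_mul (by positivity), ← Real.sqrt_mul (by positivity)]
    exact Real.le_sqrt_of_sq_le (h1.trans (by gcongr))
  calc ∑ t ∈ Finset.range m, (⟪θ, xstar⟫_ℝ - ⟪θ, y t⟫_ℝ)
      ≤ ∑ t ∈ Finset.range m, 2 * β * Real.sqrt (min 1 (armWeight lam y t)) :=
        Finset.sum_le_sum fun t ht => hround t (Finset.mem_range.1 ht)
    _ ≤ 2 * β * (Real.sqrt m * (Real.sqrt (2 * c) * Real.sqrt (d * ℓ))) := by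
        rw [← Finset.mul_sum]; gcongr
    _ = 2 * (Real.sqrt (c + 2) + Real.sqrt lam + 1) * Real.sqrt (2 * c)
        * (Real.sqrt (d * ℓ) * Real.sqrt (d * ℓ)) * Real.sqrt m := by rw [hβ]; ring
    _ = _ := by rw [Real.mul_self_sqrt (by positivity)]

end

/-! ### Mean of medians in the synthetic algorithm -/

/-- The mean of the medians of the blocks of a finite sequence. -/
noncomputable def meanBlockMedian (n k K : ℕ) (z : Fin n → ℝ) : ℝ :=
  (1 / (K : ℝ)) * ∑ j ∈ Finset.range K, blockMedian k (extendZero z) j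

lemma measurable_meanBlockMedian (n k K : ℕ) : Measurable (meanBlockMedian n k K) :=
  (Finset.measurable_sum _ fun j _ => measurable_blockMedian j).const_mul _

/-- Taking `c = s / K` in the bound for the sum gives exponent `s ^ 2 * B ^ 2 / (2 * K)`; `hB`
brings it to the scale `s ^ 2 / 4` needed for the mixture. -/
lemma setLIntegral_exp_meanBlockMedian_le {ρ : Measure ℝ} [IsProbabilityMeasure ρ]
    (hρ : IsSymmetricLaw ρ) {n k K : ℕ} {B : ℝ} (hK : 0 < K) (hB : 2 * B ^ 2 ≤ K) (s : ℝ) :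
    ∫⁻ z in boundedMedians n k K B, ENNReal.ofReal (Real.exp (s * meanBlockMedian n k K z))
          ∂(Measure.pi (fun _ : Fin n => ρ))
      ≤ ENNReal.ofReal (Real.exp (s ^ 2 / 4))
        * Measure.pi (fun _ : Fin n => ρ) (boundedMedians n k K B) := by
  have h := setLIntegral_exp_sum_blockMedian_le hρ (n := n) (k := k) (K := K) (B := B) (s / K)
  have hK' : (0 : ℝ) < K := by exact_mod_cast hK
  simp only [meanBlockMedian]
  have h1 : ∀ z : Fin n → ℝ,
      s * (1 / (K : ℝ) * ∑ j ∈ Finset.range K, blockMedian k (extendZero z) j)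
        = s / K * ∑ j ∈ Finset.range K, blockMedian k (extendZero z) j := fun z => by ring
  simp only [h1]
  refine h.trans (mul_le_mul_left (ENNReal.ofReal_le_ofReal (Real.exp_le_exp.2 ?_)) _)
  rw [show (K : ℝ) * ((s / K) ^ 2 * B ^ 2 / 2) = s ^ 2 * (B ^ 2 / (2 * K)) by
    field_simp, div_eq_mul_one_div (s ^ 2) 4]
  refine mul_le_mul_of_nonneg_left ?_ (sq_nonneg s)
  rw [div_le_div_iff₀ (by positivity) (by norm_num)]
  linarith

/-- Medians commute with translations, so the returned reward is the true mean plus the same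
statistic of the noises. -/
lemma meanOfMedians_eq {d n : ℕ} {ε : ℝ} {Ω : Type*} {θ : Vec d} {a : ℕ → Ω → Vec d}
    {r : ℕ → Ω → ℝ} {ω : Ω} {i : ℕ} (hk : 0 < blockLength n ε) (hK : 0 < blockCount n ε)
    (ha : ∀ j < n, a (i + j) ω = a i ω) :
    meanOfMedians n ε (fun j => r (i + j) ω) = ⟪θ, a i ω⟫_ℝ
      + meanBlockMedian n (blockLength n ε) (blockCount n ε) (noiseVector θ a r n i ω) := by
  set k := blockLength n ε with hk_def
  set K := blockCount n ε with hK_def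
  have hKk : K * k ≤ n := Nat.div_mul_le_self n k
  have h1 : ∀ j ∈ Finset.range K, median (fun l : Fin k => r (i + (j * k + (l : ℕ))) ω)
      = ⟪θ, a i ω⟫_ℝ + blockMedian k (extendZero (noiseVector θ a r n i ω)) j := by
    intro j hj
    rw [blockMedian, ← median_const_add hk]
    congr 1
    ext l
    have hlt : j * k + (l : ℕ) < n := by
      have h2 : (j + 1) * k ≤ K * k := Nat.mul_le_mul_right _ (Finset.mem_range.1 hj)
      have := l.2
      nlinarith
    simp only [extendZero, dif_pos hlt, noiseVector, ha _ hlt]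
    ring
  rw [meanOfMedians, meanBlockMedian, ← hk_def, ← hK_def, Finset.sum_congr rfl h1,
    Finset.sum_add_distrib, mul_add]
  have : (K : ℝ) ≠ 0 := by exact_mod_cast hK.ne'
  simp
  field_simp

/-! ### The sample size -/

section

variable {C α δ : ℝ} {T : ℕ}

lemma le_sqrt_sampleSize (C α δ : ℝ) (T : ℕ) :
    16 * Real.log (2 * T / δ) ≤ Real.sqrt (sampleSize C α δ T)
      ∧ 2 * (4 : ℝ) ^ (2 / α) * Real.log (4 / δ) ≤ Real.sqrt (sampleSize C α δ T) := by
  have h := Nat.le_ceil (max C (max ((16 * Real.log (2 * T / δ)) ^ 2)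
    ((2 * (4 : ℝ) ^ (2 / α) * Real.log (4 / δ)) ^ 2)))
  rw [← sampleSize] at h
  have h' := (le_max_right _ _).trans h
  exact ⟨Real.le_sqrt_of_sq_le ((le_max_left _ _).trans h'),
    Real.le_sqrt_of_sq_le ((le_max_right _ _).trans h')⟩

/-- `2 T / δ ≥ 2` and `16 log 2 > 11`. This slack absorbs the roundings in the block count. -/
lemma eleven_le_sqrt_sampleSize (hδ : 0 < δ) (hδ1 : δ < 1) (hT : 1 ≤ T) :
    11 ≤ Real.sqrt (sampleSize C α δ T) := by
  have hT' : (1 : ℝ) ≤ T := by exact_mod_cast hT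
  have h1 : Real.log 2 ≤ Real.log (2 * T / δ) := by
    refine Real.log_le_log (by norm_num) ?_
    rw [le_div_iff₀ hδ]; nlinarith
  have := Real.log_two_gt_d9
  linarith [(le_sqrt_sampleSize C α δ T).1]

lemma blockLength_half (n : ℕ) : blockLength n (1 / 2) = ⌈Real.sqrt n⌉₊ := by
  rw [blockLength, Real.sqrt_eq_rpow]

/-- Otherwise `n < (K + 1) (√n + 1) < (√n - 1) (√n + 1) = n - 1`, with `K` the block count. -/
lemma sqrt_sub_two_le_blockCount {n : ℕ} (hn : 0 < n) :
    Real.sqrt n - 2 ≤ blockCount n (1 / 2) := by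
  have hs : 0 < Real.sqrt n := Real.sqrt_pos.2 (by exact_mod_cast hn)
  have hss : Real.sqrt n * Real.sqrt n = n := Real.mul_self_sqrt (by positivity)
  have hk : 0 < blockLength n (1 / 2) := by rw [blockLength_half]; exact Nat.ceil_pos.2 hs
  have hk1 : (blockLength n (1 / 2) : ℝ) < Real.sqrt n + 1 := by
    rw [blockLength_half]; exact Nat.ceil_lt_add_one hs.le
  have h : n < blockCount n (1 / 2) * blockLength n (1 / 2) + blockLength n (1 / 2) :=
    Nat.lt_div_mul_add hk
  have h' : (n : ℝ) < (blockCount n (1 / 2) + 1) * blockLength n (1 / 2) := by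
    have : (n : ℝ) < blockCount n (1 / 2) * blockLength n (1 / 2) + blockLength n (1 / 2) := by
      exact_mod_cast h
    linarith
  have h2 : (n : ℝ) < (blockCount n (1 / 2) + 1) * (Real.sqrt n + 1) :=
    h'.trans_le (by gcongr)
  by_contra! hcon
  nlinarith

lemma two_mul_sq_le_blockCount (hδ : 0 < δ) (hδ1 : δ < 1) (hT : 1 ≤ T) :
    2 * ((4 : ℝ) ^ (1 / α)) ^ 2 ≤ blockCount (sampleSize C α δ T) (1 / 2) := by
  have h11 := eleven_le_sqrt_sampleSize (C := C) (α := α) hδ hδ1 hT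
  have hn : 0 < sampleSize C α δ T := by
    by_contra! h
    rw [Nat.le_zero.1 h] at h11
    norm_num at h11
  have h1 := sqrt_sub_two_le_blockCount hn
  have h2 := (le_sqrt_sampleSize C α δ T).2
  have hb : ((4 : ℝ) ^ (1 / α)) ^ 2 = (4 : ℝ) ^ (2 / α) := by
    rw [← Real.rpow_natCast, ← Real.rpow_mul (by norm_num)]
    congr 1; push_cast; ring
  have h3 : Real.log 4 ≤ Real.log (4 / δ) := by
    refine Real.log_le_log (by norm_num) ?_
    rw [le_div_iff₀ hδ]; linarith
  have h4 : Real.log 4 = 2 * Real.log 2 := by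
    rw [show (4 : ℝ) = 2 ^ 2 by norm_num, Real.log_pow]; norm_num
  have h5 := Real.log_two_gt_d9
  have hbpos : 0 < (4 : ℝ) ^ (2 / α) := by positivity
  rw [hb]
  -- `log 4 > 1.38` leaves a share of `√n` unused; as `√n ≥ 11`, that share exceeds the `2` lost to
  -- rounding.
  have h6 : 2 * (4 : ℝ) ^ (2 / α) * 1.38 ≤ 2 * (4 : ℝ) ^ (2 / α) * Real.log (4 / δ) :=
    mul_le_mul_of_nonneg_left (by linarith) (by positivity)
  linarith

lemma pow_blockLength_le (hδ : 0 < δ) (hT : 1 ≤ T) :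
    (Real.sqrt 3 / 2) ^ blockLength (sampleSize C α δ T) (1 / 2) ≤ (δ / (2 * T)) ^ 2 := by
  have hT' : (1 : ℝ) ≤ T := by exact_mod_cast hT
  -- Squared, this is `3 / 4 ≤ exp (-1 / 4)`. The rate `1 / 8` and the `16` in the sample size give
  -- the power `2`.
  have h1 : Real.sqrt 3 / 2 ≤ Real.exp (-1 / 8) := by
    refine (pow_le_pow_iff_left₀ (by positivity) (Real.exp_pos _).le two_ne_zero).1 ?_
    rw [div_pow, Real.sq_sqrt (by norm_num), ← Real.exp_nat_mul]
    have := Real.add_one_le_exp ((2 : ℕ) * (-1 / 8 : ℝ))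
    push_cast at this ⊢
    linarith
  have h2 : 16 * Real.log (2 * T / δ) ≤ blockLength (sampleSize C α δ T) (1 / 2) := by
    rw [blockLength_half]
    exact (le_sqrt_sampleSize C α δ T).1.trans (Nat.le_ceil _)
  calc (Real.sqrt 3 / 2) ^ blockLength (sampleSize C α δ T) (1 / 2)
      ≤ Real.exp (-1 / 8) ^ blockLength (sampleSize C α δ T) (1 / 2) :=
        pow_le_pow_left₀ (by positivity) h1 _
    _ = Real.exp (blockLength (sampleSize C α δ T) (1 / 2) * (-1 / 8)) :=
        (Real.exp_nat_mul _ _).symm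
    _ ≤ Real.exp ((2 : ℕ) * Real.log (δ / (2 * T))) := by
        refine Real.exp_le_exp.2 ?_
        rw [← inv_div (2 * (T : ℝ)) δ, Real.log_inv]
        push_cast
        linarith
    _ = (δ / (2 * T)) ^ 2 := by rw [Real.exp_nat_mul, Real.exp_log (by positivity)]

end

/-! ### Regret of the synthetic algorithm -/

lemma sum_range_mul_eq (f : ℕ → ℝ) (n m : ℕ) :
    ∑ i ∈ Finset.range (m * n), f i
      = ∑ t ∈ Finset.range m, ∑ j ∈ Finset.range n, f (t * n + j) := by
  induction m with
  | zero => simp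
  | succ m ih => rw [Nat.succ_mul, Finset.sum_range_add, ih, Finset.sum_range_succ]

/-- All gaps are nonnegative, so the last round may be completed. -/
lemma regret_le_mul_sum {d n m T : ℕ} {θ xstar : Vec d} {a : ℕ → Vec d}
    (hT : T ≤ m * n) (ha : ∀ t, ∀ j < n, a (t * n + j) = a (t * n))
    (hopt : ∀ i, ⟪θ, a i⟫_ℝ ≤ ⟪θ, xstar⟫_ℝ) :
    regret θ xstar a T
      ≤ n * ∑ t ∈ Finset.range m, (⟪θ, xstar⟫_ℝ - ⟪θ, a (t * n)⟫_ℝ) := by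
  calc regret θ xstar a T
      ≤ ∑ i ∈ Finset.range (m * n), (⟪θ, xstar⟫_ℝ - ⟪θ, a i⟫_ℝ) :=
        Finset.sum_le_sum_of_subset_of_nonneg (Finset.range_mono hT)
          fun i _ _ => sub_nonneg.2 (hopt i)
    _ = ∑ t ∈ Finset.range m, ∑ j ∈ Finset.range n, (⟪θ, xstar⟫_ℝ - ⟪θ, a (t * n)⟫_ℝ) := by
        rw [sum_range_mul_eq]
        refine Finset.sum_congr rfl fun t _ => Finset.sum_congr rfl fun j hj => ?_
        rw [ha t j (Finset.mem_range.1 hj)]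
    _ = _ := by simp only [Finset.sum_const, Finset.card_range, nsmul_eq_mul, Finset.mul_sum]

lemma regret_le_two_mul {d T : ℕ} {X : Set (Vec d)} {θ xstar : Vec d} {a : ℕ → Vec d}
    (hθ : ‖θ‖ ≤ 1) (hX : ∀ x ∈ X, ‖x‖ ≤ 1) (hxstar : xstar ∈ X) (ha : ∀ i, a i ∈ X) :
    regret θ xstar a T ≤ 2 * T := by
  refine (Finset.sum_le_sum (g := fun _ => (2 : ℝ)) fun i _ => ?_).trans (by simp [mul_comm])
  have h7 := abs_le.1 (abs_real_inner_le_norm θ xstar)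
  have h8 := abs_le.1 (abs_real_inner_le_norm θ (a i))
  have h9 : ‖θ‖ * ‖xstar‖ ≤ 1 := mul_le_one₀ hθ (norm_nonneg _) (hX _ hxstar)
  have h10 : ‖θ‖ * ‖a i‖ ≤ 1 := mul_le_one₀ hθ (norm_nonneg _) (hX _ (ha i))
  linarith [h7.2, h8.1]

section

variable {d : ℕ} {Ω : Type*} [mΩ : MeasurableSpace Ω] {P : Measure Ω} [IsProbabilityMeasure P]
  {ℱ : Filtration ℕ mΩ} {X : Set (Vec d)} {θ : Vec d} {ν : Kernel (Vec d) ℝ} [IsMarkovKernel ν]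
  {a : ℕ → Ω → Vec d} {r : ℕ → Ω → ℝ}

lemma IsHeavyTail.measureReal_le {α : ℝ} {ρ : Measure ℝ} (h : IsHeavyTail α ρ) :
    ρ.real {z : ℝ | (4 : ℝ) ^ (1 / α) < |z|} ≤ 1 / 4 := by
  have h1 := h.1.2 ((4 : ℝ) ^ (1 / α)) (by positivity)
  rwa [← Real.rpow_mul (by norm_num), one_div_mul_cancel h.1.1.ne', Real.rpow_one] at h1

/-- With probability at least `1 - δ` the self-normalized process of the synthetic algorithm stays
below `1 / δ ^ 2`. -/
theorem one_sub_le_measureReal_expProcess_lt {α δ C : ℝ} {T m : ℕ} (hT : 1 ≤ T) (hm0 : 0 < m)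
    (hδ : 0 < δ) (hδ1 : δ < 1) (hν : IsHeavyTailInstance α X θ ν)
    (h : IsInteraction P ℱ θ ν a r) {n k K : ℕ} (hn : n = sampleSize C α δ T)
    (hk : k = blockLength n (1 / 2)) (hK : K = blockCount n (1 / 2))
    (hm : (m : ℝ) * n ≤ 2 * T)
    (ha : ∀ᵐ ω ∂P, ∀ t, ∀ j < n, a (t * n + j) ω = a (t * n) ω)
    (hX : ∀ᵐ ω ∂P, ∀ t, a (t * n) ω ∈ X) {lam : ℝ} (hlam : 0 < lam) :
    1 - δ ≤ P.real {ω | ∀ t ≤ m, expProcess lam (fun t => a (t * n) ω)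
      (fun t => meanBlockMedian n k K (noiseVector θ a r n (t * n) ω)) t < (δ ^ 2)⁻¹} := by
  have hT' : (1 : ℝ) ≤ T := by exact_mod_cast hT
  have hKk : K * k ≤ n := by rw [hK, hk]; exact Nat.div_mul_le_self n _
  have hBK : 2 * ((4 : ℝ) ^ (1 / α)) ^ 2 ≤ K := by
    rw [hK, hn]; exact two_mul_sq_le_blockCount hδ hδ1 hT
  have hK0 : 0 < K := by
    have : (0 : ℝ) < K := lt_of_lt_of_le (by positivity) hBK
    exact_mod_cast this
  have hk0 : 0 < k := by
    rw [hk, blockLength_half, hn]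
    have := eleven_le_sqrt_sampleSize (C := C) (α := α) hδ hδ1 hT
    exact Nat.ceil_pos.2 (by linarith)
  have hKn : (K : ℝ) ≤ n := by exact_mod_cast (Nat.le_mul_of_pos_right K hk0).trans hKk
  -- Bound for the failure probability of one round. Since `m * K ≤ m * n ≤ 2 * T`, the square makes
  -- all failures together cost at most `δ / 2`.
  set u : ℝ := K * (δ / (2 * T)) ^ 2 with hu
  have hu0 : 0 ≤ u := by positivity
  have hmu : m * u ≤ δ / 2 := by
    have h1 : (m : ℝ) * K ≤ 2 * T := (by gcongr : (m : ℝ) * K ≤ m * n).trans hm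
    calc (m : ℝ) * u = m * K * (δ / (2 * T)) ^ 2 := by rw [hu]; ring
      _ ≤ 2 * T * (δ / (2 * T)) ^ 2 := by gcongr
      _ = δ ^ 2 / (2 * T) := by field_simp
      _ ≤ δ / 2 := by
        rw [div_le_div_iff₀ (by positivity) (by norm_num)]
        nlinarith
  have hpX : ∀ x ∈ X, 1 - u ≤ (roundKernel ν n x).real
      (boundedMedians n k K ((4 : ℝ) ^ (1 / α))) := by
    intro x hx
    refine le_trans ?_ (one_sub_le_measureReal_boundedMedians (ν x)
      (hν.heavyTail x hx).measureReal_le hKk)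
    have : (Real.sqrt 3 / 2) ^ k ≤ (δ / (2 * T)) ^ 2 := by
      rw [hk, hn]; exact pow_blockLength_le hδ hT
    rw [hu]
    gcongr
  have hu1 : u < 1 := by
    have : (1 : ℝ) ≤ m := by exact_mod_cast hm0
    nlinarith
  have key := h.le_measure_expProcess_lt ha hX
    (measurableSet_boundedMedians n k K ((4 : ℝ) ^ (1 / α))) (measurable_meanBlockMedian n k K)
    (p := ENNReal.ofReal (1 - u)) (by simpa using hu1)
    (fun x hx => (ENNReal.ofReal_le_ofReal (hpX x hx)).trans
      (ofReal_measureReal (measure_ne_top _ _)).le)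
    (fun x hx s => setLIntegral_exp_meanBlockMedian_le (hν.symm x hx) hK0 hBK s)
    hlam (ENNReal.ofReal (δ ^ 2)⁻¹) m
  have hδ2 : 0 < (δ ^ 2)⁻¹ := by positivity
  simp only [ENNReal.ofReal_lt_ofReal_iff hδ2] at key
  rw [← ENNReal.ofReal_inv_of_pos hδ2, inv_inv, ← ENNReal.ofReal_one,
    ← ENNReal.ofReal_sub _ (by positivity), ← ENNReal.ofReal_pow (by linarith),
    ← ENNReal.ofReal_mul (pow_nonneg (by linarith) _),
    ENNReal.ofReal_le_iff_le_toReal (measure_ne_top _ _)] at key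
  refine le_trans ?_ key
  have hbern := one_add_mul_le_pow (a := -u) (by linarith) m
  rw [← sub_eq_add_neg] at hbern
  have h1 : 1 - δ / 2 ≤ (1 - u) ^ m := by linarith
  have h2 : 0 ≤ 1 - δ ^ 2 := by nlinarith
  have h3 := mul_le_mul_of_nonneg_right h1 h2
  -- The failures of `G` and the crossing probability `δ ^ 2` fit together into `δ`.
  have h4 : (1 - δ / 2) * (1 - δ ^ 2) - (1 - δ) = δ * (1 - δ) ^ 2 / 2 := by ring
  have h5 : 0 ≤ δ * (1 - δ) ^ 2 / 2 := by positivity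
  linarith

end

/-- The constant of the regret bound. -/
noncomputable def regretConst (lam : ℝ) : ℝ :=
  2 * (Real.sqrt (Real.log (1 + 1 / lam) + 3) + Real.sqrt lam + 1)
    * Real.sqrt (2 * (Real.log (1 + 1 / lam) + 1)) * Real.sqrt 2 + 2

/-- From `1 + m / lam ≤ T (1 + 1 / lam)`; it separates the dependence on `lam` from the logarithm
`ℓ`, as a constant depending on `lam` only requires. -/
lemma log_one_add_div_le {lam ℓ : ℝ} (hlam : 0 < lam) {m T : ℕ} (hT : 1 ≤ T) (hm : m ≤ T)
    (hℓ : 1 ≤ ℓ) (hTℓ : Real.log T ≤ ℓ) :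
    Real.log (1 + m / lam) ≤ (Real.log (1 + 1 / lam) + 1) * ℓ := by
  have hT' : (1 : ℝ) ≤ T := by exact_mod_cast hT
  have hm' : (m : ℝ) ≤ T := by exact_mod_cast hm
  have hl : 0 ≤ Real.log (1 + 1 / lam) := Real.log_nonneg (by
    have : 0 < 1 / lam := by positivity
    linarith)
  have h1 : 1 + m / lam ≤ T * (1 + 1 / lam) := by
    have : m / lam ≤ T / lam := by gcongr
    have : (T : ℝ) * (1 + 1 / lam) = T + T / lam := by ring
    linarith
  have h2 := Real.log_le_log (by positivity) h1
  rw [Real.log_mul (by positivity) (by positivity)] at h2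
  nlinarith

/-- The regret bound on the event that the self-normalized process stays small. -/
theorem regret_synthetic_OFUL_le {d T : ℕ} {lam α δ C : ℝ} (hlam : 0 < lam) (hd : 0 < d)
    (hT : 1 ≤ T) (hδ : 0 < δ) (hδ1 : δ < 1) {X : Set (Vec d)} {θ xstar : Vec d}
    (hθ : ‖θ‖ ≤ 1) (hX : ∀ x ∈ X, ‖x‖ ≤ 1) (hxstar : xstar ∈ X)
    (hopt : ∀ x ∈ X, ⟪θ, x⟫_ℝ ≤ ⟪θ, xstar⟫_ℝ) {n m : ℕ} (hn : n = sampleSize C α δ T)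
    (hTm : T ≤ m * n) (hmT : m * n ≤ 2 * T) {x a : ℕ → Vec d} {r : ℕ → ℝ}
    (hrun : IsSyntheticRun (OFUL X 1 1 lam δ) (1 / 2) n x a r) {η : ℕ → ℝ}
    (hη : ∀ t, meanOfMedians n (1 / 2) (fun i => r (t * n + i)) = ⟪θ, a (t * n)⟫_ℝ + η t)
    (hsmall : ∀ t ≤ m, expProcess lam (fun t => a (t * n)) η t < (δ ^ 2)⁻¹) :
    regret θ xstar a T ≤ regretConst lam * d * Real.sqrt (n * T) * (1 + Real.log (T / δ)) := by
  have hT' : (1 : ℝ) ≤ T := by exact_mod_cast hT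
  have h11 := eleven_le_sqrt_sampleSize (C := C) (α := α) hδ hδ1 hT
  rw [← hn] at h11
  have hn2 : 2 ≤ n := by
    by_contra! h
    have h1 : (n : ℝ) ≤ 1 := by exact_mod_cast Nat.lt_succ_iff.1 h
    have : Real.sqrt n ≤ 1 := Real.sqrt_le_one.2 h1
    linarith
  have hx : ∀ t, a (t * n) = x t := fun t => by simpa using hrun.pull_eq t 0 (by omega)
  have hax : ∀ t, ∀ j < n, a (t * n + j) = a (t * n) := fun t j hj => by
    rw [hx, hrun.pull_eq t j hj]
  have haX : ∀ i, a i ∈ X := by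
    intro i
    have := hrun.pull_eq (i / n) (i % n) (Nat.mod_lt _ (by omega))
    rw [Nat.div_add_mod'] at this
    rw [this]
    exact (hrun.choice _).1
  set ℓ : ℝ := 1 + Real.log (T / δ) with hℓ
  have hlogT : 0 ≤ Real.log T := Real.log_nonneg hT'
  have hlogδ : Real.log δ ≤ 0 := Real.log_nonpos hδ.le hδ1.le
  have hℓ' : ℓ = 1 + Real.log T - Real.log δ := by
    rw [hℓ, Real.log_div (by positivity) hδ.ne']; ring
  have hmT' : m ≤ T := by nlinarith
  set c : ℝ := Real.log (1 + 1 / lam) + 1 with hc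
  have hc0 : 0 ≤ c := by
    have : 0 ≤ Real.log (1 + 1 / lam) := Real.log_nonneg (by
      have : 0 < 1 / lam := by positivity
      linarith)
    linarith
  have hchoice : ∀ t < m, a (t * n) ∈ OFUL X 1 1 lam δ t
      (fun s : Fin t => (a (s * n), ⟪θ, a (s * n)⟫_ℝ + η s)) := by
    intro t _
    have := hrun.choice t
    simp only [hη, ← hx] at this
    exact this
  have hconf : ∀ t < m, θ ∈ confidenceSet 1 1 lam δ
      (fun s : Fin t => (a (s * n), ⟪θ, a (s * n)⟫_ℝ + η s)) := fun t ht =>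
    mem_confidenceSet (y := fun s => a (s * n)) hlam hθ hδ η (hsmall t ht.le)
  have hmℓ := log_one_add_div_le hlam hT hmT' (show 1 ≤ ℓ by linarith) (by linarith)
  have hsum := sum_regret_le (y := fun t => a (t * n)) (ρ := fun t => ⟪θ, a (t * n)⟫_ℝ + η t)
    hlam hd hθ hX hxstar hδ hc0 (show 1 ≤ ℓ by linarith) (by linarith) hmℓ hchoice hconf
  refine (regret_le_mul_sum hTm hax fun i => hopt _ (haX i)).trans ?_
  -- The square of the left side is `n * (m * n)`.
  have hnm : (n : ℝ) * Real.sqrt m ≤ Real.sqrt 2 * Real.sqrt (n * T) := by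
    rw [← Real.sqrt_mul (by norm_num)]
    refine Real.le_sqrt_of_sq_le ?_
    rw [mul_pow, Real.sq_sqrt (by positivity)]
    have : (m : ℝ) * n ≤ 2 * T := by exact_mod_cast hmT
    nlinarith [Nat.cast_nonneg (α := ℝ) n]
  have hreg : regretConst lam = 2 * (Real.sqrt (c + 2) + Real.sqrt lam + 1)
      * Real.sqrt (2 * c) * Real.sqrt 2 + 2 := by
    rw [regretConst, hc, show Real.log (1 + 1 / lam) + 1 + 2 = Real.log (1 + 1 / lam) + 3 by ring]
  set A : ℝ := 2 * (Real.sqrt (c + 2) + Real.sqrt lam + 1) * Real.sqrt (2 * c) with hA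
  have hA0 : 0 ≤ A := by positivity
  have hℓ0 : 0 ≤ ℓ := by linarith
  calc (n : ℝ) * ∑ t ∈ Finset.range m, (⟪θ, xstar⟫_ℝ - ⟪θ, a (t * n)⟫_ℝ)
      ≤ n * (A * (d * ℓ) * Real.sqrt m) := by gcongr
    _ = A * (d * ℓ) * (n * Real.sqrt m) := by ring
    _ ≤ A * (d * ℓ) * (Real.sqrt 2 * Real.sqrt (n * T)) := by gcongr
    _ ≤ A * (d * ℓ) * (Real.sqrt 2 * Real.sqrt (n * T)) + 2 * (d * ℓ) * Real.sqrt (n * T) :=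
        le_add_of_nonneg_right (by positivity)
    _ = regretConst lam * d * Real.sqrt (n * T) * ℓ := by rw [hreg]; ring

end HeavyTailBandit

/-! ### The regret bound -/

open HeavyTailBandit in
theorem corollary1 (lam : ℝ) (hlam : 0 < lam) :
    ∃ K : ℝ, 0 < K ∧
      ∀ (d T : ℕ) (α δ C : ℝ), 1 ≤ T → 0 < α → 0 < δ → δ < 1 →
      0 < C → 2 * Real.sqrt C * Real.exp (-Real.sqrt C / 16) ≤ 1 →
      ∀ (X : Set (HeavyTailBandit.Vec d)) (θ xstar : HeavyTailBandit.Vec d)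
        (ν : Kernel (HeavyTailBandit.Vec d) ℝ) [IsMarkovKernel ν],
      HeavyTailBandit.IsHeavyTailInstance α X θ ν →
      xstar ∈ X → (∀ x ∈ X, ⟪θ, x⟫_ℝ ≤ ⟪θ, xstar⟫_ℝ) →
      ∀ {Ω : Type*} [mΩ : MeasurableSpace Ω] (P : Measure Ω) [IsProbabilityMeasure P]
        (ℱ : Filtration ℕ mΩ) (x a : ℕ → Ω → HeavyTailBandit.Vec d) (r : ℕ → Ω → ℝ),
      HeavyTailBandit.IsInteraction P ℱ θ ν a r →
      (∀ᵐ ω ∂P, HeavyTailBandit.IsSyntheticRun (HeavyTailBandit.OFUL X 1 1 lam δ) (1 / 2)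
        (HeavyTailBandit.sampleSize C α δ T)
        (fun t => x t ω) (fun i => a i ω) (fun i => r i ω)) →
      1 - δ ≤ P.real {ω | HeavyTailBandit.regret θ xstar (fun i => a i ω) T ≤
        K * d * Real.sqrt (HeavyTailBandit.sampleSize C α δ T * T) * (1 + Real.log (T / δ))} := by
  have hc : 0 ≤ Real.log (1 + 1 / lam) := Real.log_nonneg (by
    have : 0 < 1 / lam := by positivity
    linarith)
  refine ⟨regretConst lam, by unfold regretConst; positivity, ?_⟩
  intro d T α δ C hT hα hδ hδ1 _ _ X θ xstar ν _ hν hxstar hopt Ω mΩ P _ ℱ x a r hint hrun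
  have hT' : (1 : ℝ) ≤ T := by exact_mod_cast hT
  set n := sampleSize C α δ T with hn
  have h11 := eleven_le_sqrt_sampleSize (C := C) (α := α) hδ hδ1 hT
  rw [← hn] at h11
  have hn0 : 0 < n := by
    by_contra! h
    rw [Nat.le_zero.1 h] at h11
    norm_num at h11
  have hlog : 0 ≤ Real.log (T / δ) :=
    Real.log_nonneg (by rw [le_div_iff₀ hδ]; linarith)
  have hfull : ∀ s : Set Ω, (∀ᵐ ω ∂P, ω ∈ s) → 1 - δ ≤ P.real s := by
    intro s hs
    have : P s = P Set.univ := measure_congr (Filter.eventuallyEq_univ.2 hs)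
    rw [measureReal_def, this, measure_univ, ENNReal.toReal_one]
    linarith
  rcases Nat.eq_zero_or_pos d with rfl | hd
  · refine hfull _ (ae_of_all _ fun ω => ?_)
    have h0 : ∀ v : Vec 0, ⟪θ, v⟫_ℝ = 0 := fun v => by
      rw [Subsingleton.elim v 0, inner_zero_right]
    simp [regret, h0]
  have hd1 : (1 : ℝ) ≤ d := by exact_mod_cast hd
  have hpull : ∀ᵐ ω ∂P, ∀ t, ∀ j < n, a (t * n + j) ω = x t ω :=
    hrun.mono fun ω hω t j hj => hω.pull_eq t j hj
  have hax : ∀ᵐ ω ∂P, ∀ t, ∀ j < n, a (t * n + j) ω = a (t * n) ω :=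
    hpull.mono fun ω hω t j hj => by
      have := hω t 0 hn0
      rw [add_zero] at this
      rw [hω t j hj, this]
  have haX : ∀ᵐ ω ∂P, ∀ i, a i ω ∈ X := by
    refine hrun.mono fun ω hω i => ?_
    have := hω.pull_eq (i / n) (i % n) (Nat.mod_lt _ hn0)
    rw [Nat.div_add_mod'] at this
    rw [this]
    exact (hω.choice _).1
  -- If `T ≤ n`, not even one round need be complete, but `2 * T ≤ 2 * √(n T)`; the summand `2` in
  -- `regretConst` is there for this case. If `n < T`, rounding up to `m = T / n + 1` rounds at most
  -- doubles the number of pulls.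
  rcases le_or_gt T n with hTn | hTn
  · refine hfull _ (haX.mono fun ω hω => ?_)
    refine (regret_le_two_mul hν.norm_param_le hν.norm_arm_le hxstar hω).trans ?_
    have h1 : (T : ℝ) ≤ Real.sqrt (n * T) := by
      refine Real.le_sqrt_of_sq_le ?_
      have : (T : ℝ) ≤ n := by exact_mod_cast hTn
      nlinarith
    have h2 : 2 ≤ regretConst lam := by
      unfold regretConst
      exact le_add_of_nonneg_left (by positivity)
    calc 2 * (T : ℝ) = 2 * 1 * T * 1 := by ring
      _ ≤ regretConst lam * d * Real.sqrt (n * T) * (1 + Real.log (T / δ)) := by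
        gcongr; linarith
  · set m := T / n + 1 with hm
    have hTm : T ≤ m * n := by
      rw [hm, Nat.succ_mul]; exact (Nat.lt_div_mul_add hn0).le
    have hmT : m * n ≤ 2 * T := by
      rw [hm, Nat.succ_mul]
      have := Nat.div_mul_le_self T n
      omega
    have hgood := one_sub_le_measureReal_expProcess_lt (m := m) hT (Nat.succ_pos _) hδ hδ1 hν hint hn rfl
      rfl (by exact_mod_cast hmT) hax (haX.mono fun ω hω t => hω _) hlam
    refine hgood.trans ?_
    rw [measureReal_def, measureReal_def]
    refine ENNReal.toReal_mono (measure_ne_top _ _) (measure_mono_ae ?_)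
    filter_upwards [hrun, hax] with ω hω hωa hsmall
    have hk0 : 0 < blockLength n (1 / 2) := by
      rw [blockLength_half]; exact Nat.ceil_pos.2 (by linarith)
    have hK0 : 0 < blockCount n (1 / 2) := by
      have : (0 : ℝ) < blockCount n (1 / 2) :=
        lt_of_lt_of_le (by linarith) (sqrt_sub_two_le_blockCount hn0)
      exact_mod_cast this
    exact regret_synthetic_OFUL_le hlam hd hT hδ hδ1 hν.norm_param_le hν.norm_arm_le hxstar hopt hn
      hTm hmT hω (fun t => meanOfMedians_eq hk0 hK0 (hωa t)) hsmall
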